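/- All maps are bipartite planar maps (connected graphs properly embedded in the sphere, up to orientation-preserving homeomorphism), endowed with one of their two proper black/white colourings; loops are thus excluded and multiple edges are allowed. *Cuts.* Given two distinct vertices $\rho,\tau$ of a map $\mathrm m$, a cut is a partition $(R,S)$ of the vertex set with $\rho\in R$, $\tau\in S$; its weight is the number of edges joining $R$ to $S$. It is black (resp. white) if all vertices of $S$ incident to such edges are black (resp. white). A black (resp. white) cut is minimal if its weight is minimal among all black (resp. white) cuts. *Doubly rooted maps.* A doubly rooted map $(\mathrm m,\rho_1,\rho_2)$ is a map with two marked corners, incident to two different vertices $\rho_1,\rho_2$; cuts are taken with $\rho=\rho_1$, $\tau=\rho_2$. If black cuts exist, and the black cuts of minimal weight are the $(R,S)\in\mathcal C_\bullet$, put $S_{\min}=\bigcap_{(R,S)\in\mathcal C_\bullet}S$ and let $R_{\min}$ be its complement. *d-trumpets and d-cornets.* Let $(\mathrm m,\tau)$ be a map rooted at a corner, with root vertex $\rho$, and with a marked vertex $\tau\neq\rho$. It is a d-trumpet if $\tau$ is black and the trivial cut $(\mathrm V(\mathrm m)\setminus\{\tau\},\{\tau\})$ is a minimal black cut. It is a d-cornet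 if $\tau$ is white and the trivial cut is the unique minimal white cut. **Proposition.** Let $k\ge 1$. Let $\mathcal D_k$ be the set of doubly rooted maps that have a black cut and whose black cuts have minimal weight $k$. Let $\mathcal T_k$ (resp. $\mathcal K_k$) be the set of d-trumpets (resp. d-cornets) with $\deg\tau=k$. 1. For every $\mathrm m\in\mathcal D_k$, $(R_{\min},S_{\min})$ is itself a black cut of minimal weight $k$. 2. Cutting along this minimal black cut is a well-defined map $\Phi:\mathcal D_k\to\mathcal T_k\times\mathcal K_k$. Here $\Phi(\mathrm m)=((\mathrm m_1,\tau_1),(\mathrm m_2,\tau_2))$ is given as follows: $\mathrm m_1$ (resp. $\mathrm m_2$) is the planar map obtained by keeping the vertices of $R_{\min}$ (resp. $S_{\min}$), with the half-edges around them and their cyclic orders, and the edges between them, and by connecting the half-edges belonging to the $k$ cut edges to a new vertex $\tau_1$ (resp. $\tau_2$); it is rooted at the first (resp. second) marked corner of $\mathrm m$. 3. $\Phi$ is $k$-to-one: every pair in $\mathcal T_k\times\mathcal K_k$ has exactly $k$ preimages. 4. For every pair $((\mathrm m_1,\tau_1),(\mathrm m_2,\tau_2))\in\mathcal T_k\times\mathcal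 K_k$, delete $\tau_1$ and $\tau_2$ and consider the bijections between the $k$ stems left at $\tau_1$ and the $k$ stems left at $\tau_2$. Exactly $k$ of them produce a planar map when matched stems are merged into edges, and the preimages of the pair under $\Phi$ are exactly the doubly rooted maps obtained in these $k$ ways. -/

import Mathlib

/-- The two colours of the vertices of a bipartite map. -/
inductive Colour : Type
  | black : Colour
  | white : Colour

/-- A finite bipartite graph without isolated vertices, drawn on an oriented closed surface and
properly coloured, encoded in the usual way by half-edges (darts): `rot` sends a half-edge to the
next one in counterclockwise order around its vertex, and `opp` exchanges the two half-edges of an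
edge.  A half-edge carries the colour of the vertex to which it is incident.
Neither connectedness nor planarity is required at this stage. -/
structure RibbonGraph : Type 1 where
  Dart : Type
  finite : Finite Dart
  rot : Equiv.Perm Dart
  opp : Equiv.Perm Dart
  opp_opp : ∀ d, opp (opp d) = d
  colour : Dart → Colour
  colour_rot : ∀ d, colour (rot d) = colour d
  colour_opp : ∀ d, colour (opp d) ≠ colour d

attribute [instance] RibbonGraph.finite

namespace RibbonGraph

variable (M : RibbonGraph)

/-- Vertices are the cycles of `rot`. -/
def Vertex : Type := Quotient (Equiv.Perm.SameCycle.setoid M.rot)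

/-- Edges are the cycles of `opp`. -/
def Edge : Type := Quotient (Equiv.Perm.SameCycle.setoid M.opp)

/-- Faces are the cycles of `rot ∘ opp` (walking along the boundary with the face on the right). -/
def Face : Type := Quotient (Equiv.Perm.SameCycle.setoid (M.rot * M.opp))

/-- The vertex incident to a half-edge. -/
def vert (d : M.Dart) : M.Vertex := Quotient.mk (Equiv.Perm.SameCycle.setoid M.rot) d

theorem vert_eq_iff (x y : M.Dart) : M.vert x = M.vert y ↔ M.rot.SameCycle x y :=
  Quotient.eq (r := Equiv.Perm.SameCycle.setoid M.rot)

theorem vert_rot (d : M.Dart) : M.vert (M.rot d) = M.vert d :=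
  (M.vert_eq_iff _ _).2 ⟨-1, by simp⟩

theorem eq_of_sameCycle {α : Type*} (f : M.Dart → α) (hf : ∀ d, f (M.rot d) = f d)
    {x y : M.Dart} (h : M.rot.SameCycle x y) : f x = f y := by
  obtain ⟨i, rfl⟩ := h
  induction i with
  | zero => simp
  | succ n ih => rw [add_comm, zpow_add, zpow_one, Equiv.Perm.mul_apply, hf, ih]
  | pred n ih =>
    rw [ih, ← hf ((M.rot ^ (-(n : ℤ) - 1)) x), ← Equiv.Perm.mul_apply, ← zpow_one_add]
    congr 3
    ring

theorem colour_eq_of_sameCycle {x y : M.Dart} (h : M.rot.SameCycle x y) :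
    M.colour x = M.colour y :=
  M.eq_of_sameCycle M.colour M.colour_rot h

/-- The colour of a vertex. -/
def vertColour (v : M.Vertex) : Colour :=
  Quotient.lift (s := Equiv.Perm.SameCycle.setoid M.rot) M.colour
    (fun _ _ h => M.colour_eq_of_sameCycle h) v

theorem vert_opp_ne (d : M.Dart) : M.vert (M.opp d) ≠ M.vert d := fun h =>
  M.colour_opp d (M.colour_eq_of_sameCycle ((M.vert_eq_iff _ _).1 h))

/-- The degree of a vertex: the number of half-edges (equivalently, corners) incident to it. -/
noncomputable def degree (v : M.Vertex) : ℕ := {d : M.Dart | M.vert d = v}.ncard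

/-- `M` is a planar map: it is connected and drawn on the sphere (Euler's relation).
The relation also forces `M` to have at least one edge. -/
def IsPlanarMap : Prop :=
  (∀ x y : M.Dart, ∃ g ∈ Subgroup.closure {M.rot, M.opp}, g x = y) ∧
    Nat.card M.Vertex + Nat.card M.Face = Nat.card M.Edge + 2

/-- Colour-preserving and orientation-preserving isomorphisms. -/
structure Iso (M N : RibbonGraph) where
  toEquiv : M.Dart ≃ N.Dart
  map_rot : ∀ d, toEquiv (M.rot d) = N.rot (toEquiv d)
  map_opp : ∀ d, toEquiv (M.opp d) = N.opp (toEquiv d)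
  map_colour : ∀ d, N.colour (toEquiv d) = M.colour d

/-- Identity isomorphism. -/
def Iso.refl (M : RibbonGraph) : Iso M M :=
  ⟨Equiv.refl _, fun _ => rfl, fun _ => rfl, fun _ => rfl⟩

/-- Inverse isomorphism. -/
def Iso.symm {M N : RibbonGraph} (e : Iso M N) : Iso N M where
  toEquiv := e.toEquiv.symm
  map_rot d := by rw [Equiv.symm_apply_eq, e.map_rot, Equiv.apply_symm_apply]
  map_opp d := by rw [Equiv.symm_apply_eq, e.map_opp, Equiv.apply_symm_apply]
  map_colour d := by rw [← e.map_colour, Equiv.apply_symm_apply]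

/-- Composition of isomorphisms. -/
def Iso.trans {M N P : RibbonGraph} (e : Iso M N) (f : Iso N P) : Iso M P where
  toEquiv := e.toEquiv.trans f.toEquiv
  map_rot d := by simp [e.map_rot, f.map_rot]
  map_opp d := by simp [e.map_opp, f.map_opp]
  map_colour d := by simp [e.map_colour, f.map_colour]

/-! ### Cuts

A cut `(R, S)` is given by its part `S`; the other part is `R = Sᶜ`. -/

/-- The cut-set of `(Sᶜ, S)`, each edge being represented by its half-edge on the side of `S`. -/
def cutSet (S : Set M.Vertex) : Set M.Dart := {d | M.vert d ∈ S ∧ M.vert (M.opp d) ∉ S}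

/-- The weight of a cut: the number of edges of its cut-set. -/
noncomputable def cutWeight (S : Set M.Vertex) : ℕ := (M.cutSet S).ncard

/-- `(Sᶜ, S)` is a cut with `ρ ∈ Sᶜ`, `τ ∈ S`, of colour `c`: all vertices of `S` incident to edges
of the cut-set have colour `c`. -/
def IsCut (c : Colour) (ρ τ : M.Vertex) (S : Set M.Vertex) : Prop :=
  ρ ∈ Sᶜ ∧ τ ∈ S ∧ ∀ d ∈ M.cutSet S, M.vertColour (M.vert d) = c

/-- A cut of colour `c` which has minimal weight among all cuts of colour `c`. -/
def IsMinimalCut (c : Colour) (ρ τ : M.Vertex) (S : Set M.Vertex) : Prop :=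
  M.IsCut c ρ τ S ∧ ∀ S', M.IsCut c ρ τ S' → M.cutWeight S ≤ M.cutWeight S'

end RibbonGraph

/-! ### Doubly rooted bipartite planar maps -/

/-- A bipartite planar map with two marked corners incident to two different vertices.  A corner is
identified with the half-edge that it follows. -/
structure DoublyRootedMap : Type 1 where
  M : RibbonGraph
  planar : M.IsPlanarMap
  corner₁ : M.Dart
  corner₂ : M.Dart
  root_ne : M.vert corner₁ ≠ M.vert corner₂

namespace DoublyRootedMap

/-- Two doubly rooted maps are the same when an isomorphism respects the two marked corners. -/
def Equivalent (m m' : DoublyRootedMap) : Prop :=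
  ∃ e : RibbonGraph.Iso m.M m'.M,
    e.toEquiv m.corner₁ = m'.corner₁ ∧ e.toEquiv m.corner₂ = m'.corner₂

instance isoSetoid : Setoid DoublyRootedMap where
  r := Equivalent
  iseqv :=
    { refl := fun m => ⟨RibbonGraph.Iso.refl _, rfl, rfl⟩
      symm := by
        rintro m m' ⟨e, h₁, h₂⟩
        exact ⟨e.symm, (Equiv.symm_apply_eq _).2 h₁.symm, (Equiv.symm_apply_eq _).2 h₂.symm⟩
      trans := by
        rintro m m' m'' ⟨e, h₁, h₂⟩ ⟨f, g₁, g₂⟩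
        refine ⟨e.trans f, ?_, ?_⟩
        · simp [RibbonGraph.Iso.trans, h₁, g₁]
        · simp [RibbonGraph.Iso.trans, h₂, g₂] }

variable (m : DoublyRootedMap)

/-- First root vertex. -/
def ρ₁ : m.M.Vertex := m.M.vert m.corner₁

/-- Second root vertex. -/
def ρ₂ : m.M.Vertex := m.M.vert m.corner₂

/-- The black cuts of minimal weight. -/
def minimalBlackCuts : Set (Set m.M.Vertex) :=
  {S | m.M.IsMinimalCut Colour.black m.ρ₁ m.ρ₂ S}

/-- Black cuts exist, and their minimal weight is `k`. -/
def HasMinBlackCutWeight (k : ℕ) : Prop := ∃ S ∈ m.minimalBlackCuts, m.M.cutWeight S = k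

/-- The part `S` of the minimal black cut: the intersection of the parts `S` of all black cuts of
minimal weight. -/
def Smin : Set m.M.Vertex := ⋂₀ m.minimalBlackCuts

/-- The part `R` of the minimal black cut. -/
def Rmin : Set m.M.Vertex := m.Sminᶜ

end DoublyRootedMap

/-! ### d-trumpets and d-cornets -/

/-- A rooted bipartite planar map with an additional marked vertex `τ`, different from the root
vertex (this is needed for cuts to exist). -/
structure PointedMap : Type 1 where
  M : RibbonGraph
  planar : M.IsPlanarMap
  corner : M.Dart
  τ : M.Vertex
  root_ne : M.vert corner ≠ τ

namespace PointedMap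

/-- Two pointed rooted maps are the same when an isomorphism respects the root corner and the
marked vertex. -/
def Equivalent (P Q : PointedMap) : Prop :=
  ∃ e : RibbonGraph.Iso P.M Q.M,
    e.toEquiv P.corner = Q.corner ∧ ∀ d, Q.M.vert (e.toEquiv d) = Q.τ ↔ P.M.vert d = P.τ

instance isoSetoid : Setoid PointedMap where
  r := Equivalent
  iseqv :=
    { refl := fun m => ⟨RibbonGraph.Iso.refl _, rfl, fun _ => Iff.rfl⟩
      symm := by
        rintro P Q ⟨e, h₁, h₂⟩
        refine ⟨e.symm, (Equiv.symm_apply_eq _).2 h₁.symm, fun d => ?_⟩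
        rw [← h₂]
        simp [RibbonGraph.Iso.symm]
      trans := by
        rintro P Q T ⟨e, h₁, h₂⟩ ⟨f, g₁, g₂⟩
        refine ⟨e.trans f, by simp [RibbonGraph.Iso.trans, h₁, g₁], fun d => ?_⟩
        simp [RibbonGraph.Iso.trans, h₂, g₂] }

variable (P : PointedMap)

/-- The root vertex. -/
def ρ : P.M.Vertex := P.M.vert P.corner

/-- A cut of the colour of `τ` and of minimal weight among these. -/
def IsMinimalCut (S : Set P.M.Vertex) : Prop :=
  P.M.IsMinimalCut (P.M.vertColour P.τ) P.ρ P.τ S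

/-- The trivial cut, with `S = {τ}`, is minimal. -/
def IsTight : Prop := P.IsMinimalCut {P.τ}

/-- The trivial cut is the unique minimal cut of its colour. -/
def IsStrictlyTight : Prop := P.IsTight ∧ ∀ S, P.IsMinimalCut S → S = {P.τ}

/-- d-trumpets. -/
def IsTrumpet : Prop := P.IsTight ∧ P.M.vertColour P.τ = Colour.black

/-- d-cornets. -/
def IsCornet : Prop := P.IsStrictlyTight ∧ P.M.vertColour P.τ = Colour.white

end PointedMap

/-- Representatives of doubly rooted maps with minimal black-cut weight `k`. -/
def DoublyRooted (k : ℕ) : Type 1 := {m : DoublyRootedMap // m.HasMinBlackCutWeight k}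

/-- Representatives of d-trumpets with marked vertex of degree `k`. -/
def Trumpet (k : ℕ) : Type 1 := {P : PointedMap // P.IsTrumpet ∧ P.M.degree P.τ = k}

/-- Representatives of d-cornets with marked vertex of degree `k`. -/
def Cornet (k : ℕ) : Type 1 := {P : PointedMap // P.IsCornet ∧ P.M.degree P.τ = k}

/-- Isomorphism, restricted to `DoublyRooted k`. -/
instance DoublyRooted.isoSetoid (k : ℕ) : Setoid (DoublyRooted k) :=
  Setoid.comap Subtype.val DoublyRootedMap.isoSetoid

/-- Isomorphism, restricted to `Trumpet k`. -/
instance Trumpet.isoSetoid (k : ℕ) : Setoid (Trumpet k) :=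
  Setoid.comap Subtype.val PointedMap.isoSetoid

/-- Isomorphism, restricted to `Cornet k`. -/
instance Cornet.isoSetoid (k : ℕ) : Setoid (Cornet k) :=
  Setoid.comap Subtype.val PointedMap.isoSetoid

/-- The set of doubly rooted bipartite planar maps with minimal black-cut weight `k`
(maps are considered up to isomorphism). -/
def DoublyRootedMaps (k : ℕ) : Type 1 := Quotient (DoublyRooted.isoSetoid k)

/-- The set of d-trumpets with marked vertex of degree `k`. -/
def Trumpets (k : ℕ) : Type 1 := Quotient (Trumpet.isoSetoid k)

/-- The set of d-cornets with marked vertex of degree `k`. -/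
def Cornets (k : ℕ) : Type 1 := Quotient (Cornet.isoSetoid k)

/-- The class of a doubly rooted map. -/
def DoublyRooted.cls {k : ℕ} (m : DoublyRooted k) : DoublyRootedMaps k :=
  Quotient.mk (DoublyRooted.isoSetoid k) m

/-- The class of a d-trumpet. -/
def Trumpet.cls {k : ℕ} (t : Trumpet k) : Trumpets k := Quotient.mk (Trumpet.isoSetoid k) t

/-- The class of a d-cornet. -/
def Cornet.cls {k : ℕ} (c : Cornet k) : Cornets k := Quotient.mk (Cornet.isoSetoid k) c

/-! ### Cutting -/

/-- `P` is obtained from `M` by keeping the vertices of `A`, their half-edges with their cyclic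
orders and colours, and the edges with both ends in `A`, and by connecting to a new vertex `τ` each
half-edge incident to `A` whose edge leaves `A`; the root of `P` is the corner `r` of `M`.
(The cyclic order around `τ` is the one for which `P` is planar.) -/
def IsPiece (M : RibbonGraph) (A : Set M.Vertex) (r : M.Dart) (P : PointedMap) : Prop :=
  ∃ f : {d : M.Dart // M.vert d ∈ A} ≃ {d : P.M.Dart // P.M.vert d ≠ P.τ},
    (∀ x y, y.1 = M.rot x.1 → (f y).1 = P.M.rot (f x).1) ∧
    (∀ x, P.M.colour (f x).1 = M.colour x.1) ∧
    (∀ x y, y.1 = M.opp x.1 → (f y).1 = P.M.opp (f x).1) ∧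
    (∀ x, M.vert (M.opp x.1) ∉ A → P.M.vert (P.M.opp (f x).1) = P.τ) ∧
    ∃ h : M.vert r ∈ A, (f ⟨r, h⟩).1 = P.corner

/-- Cutting `m` along its minimal black cut produces `P` (on the side of `ρ₁`) and `Q` (on the side
of `ρ₂`). -/
def CutsInto (m : DoublyRootedMap) (P Q : PointedMap) : Prop :=
  IsPiece m.M m.Rmin m.corner₁ P ∧ IsPiece m.M m.Smin m.corner₂ Q

/-! ### Regluing -/

section Glue

/-- A matching of the half-edges incident to the marked vertices of `P` and of `Q`. -/
abbrev Matching (P Q : PointedMap) : Type :=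
  {d : P.M.Dart // P.M.vert d = P.τ} ≃ {d : Q.M.Dart // Q.M.vert d = Q.τ}

theorem PointedMap.opp_vert_ne (P : PointedMap) (d : P.M.Dart) (h : P.M.vert d = P.τ) :
    P.M.vert (P.M.opp d) ≠ P.τ := fun h' => P.M.vert_opp_ne d (h'.trans h.symm)

/-- The half-edges which remain when the marked vertex is deleted. -/
abbrev PointedMap.Rest (P : PointedMap) : Type := {d : P.M.Dart // P.M.vert d ≠ P.τ}

open Classical in
/-- The half-edge opposite to `x` after deletion of the marked vertices and gluing along `β`. -/
noncomputable def glueHalf (P Q : PointedMap) (β : Matching P Q) (x : P.Rest) :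
    P.Rest ⊕ Q.Rest :=
  if h : P.M.vert (P.M.opp x.1) = P.τ then
    Sum.inr ⟨Q.M.opp (β ⟨P.M.opp x.1, h⟩).1, Q.opp_vert_ne _ (β ⟨P.M.opp x.1, h⟩).2⟩
  else Sum.inl ⟨P.M.opp x.1, h⟩

/-- Opposite half-edge in the glued map: edges which avoid the marked vertices are kept, and the
stem left by `d` at `P.τ` is merged with the stem left by `β d` at `Q.τ`. -/
noncomputable def glueOpp (P Q : PointedMap) (β : Matching P Q) :
    P.Rest ⊕ Q.Rest → P.Rest ⊕ Q.Rest :=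
  Sum.elim (glueHalf P Q β) (fun y => (glueHalf Q P β.symm y).swap)

theorem glueHalf_stem (P Q : PointedMap) (β : Matching P Q) (x : P.Rest)
    (h : P.M.vert (P.M.opp x.1) = P.τ) :
    glueHalf P Q β x =
      Sum.inr ⟨Q.M.opp (β ⟨P.M.opp x.1, h⟩).1, Q.opp_vert_ne _ (β ⟨P.M.opp x.1, h⟩).2⟩ :=
  dif_pos h

theorem glueHalf_inner (P Q : PointedMap) (β : Matching P Q) (x : P.Rest)
    (h : P.M.vert (P.M.opp x.1) ≠ P.τ) :
    glueHalf P Q β x = Sum.inl ⟨P.M.opp x.1, h⟩ :=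
  dif_neg h

theorem glueOpp_inl (P Q : PointedMap) (β : Matching P Q) (x : P.Rest) :
    glueOpp P Q β (glueOpp P Q β (Sum.inl x)) = Sum.inl x := by
  by_cases h : P.M.vert (P.M.opp x.1) = P.τ
  · have h2 : Q.M.vert (Q.M.opp (Q.M.opp (β ⟨P.M.opp x.1, h⟩).1)) = Q.τ := by
      rw [Q.M.opp_opp]; exact (β ⟨P.M.opp x.1, h⟩).2
    simp only [glueOpp, Sum.elim_inl]
    rw [glueHalf_stem P Q β x h, Sum.elim_inr, glueHalf_stem Q P β.symm _ h2]
    simp [Q.M.opp_opp, P.M.opp_opp]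
  · have h2 : P.M.vert (P.M.opp (P.M.opp x.1)) ≠ P.τ := by
      rw [P.M.opp_opp]; exact x.2
    simp only [glueOpp, Sum.elim_inl]
    rw [glueHalf_inner P Q β x h, Sum.elim_inl, glueHalf_inner P Q β _ h2]
    simp [P.M.opp_opp]

theorem glueOpp_swap (P Q : PointedMap) (β : Matching P Q) (z : P.Rest ⊕ Q.Rest) :
    glueOpp P Q β z = (glueOpp Q P β.symm z.swap).swap := by
  rcases z with x | y <;> simp [glueOpp]

theorem glueOpp_involutive (P Q : PointedMap) (β : Matching P Q) :
    Function.Involutive (glueOpp P Q β) := by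
  rintro (x | y)
  · exact glueOpp_inl P Q β x
  · rw [glueOpp_swap, glueOpp_swap P Q β (Sum.inr y), Sum.swap_swap, Sum.swap_inr,
      glueOpp_inl, Sum.swap_inl]

theorem colour_eq_of_ne {a b c : Colour} (h₁ : a ≠ b) (h₂ : b ≠ c) : a = c := by
  cases a <;> cases b <;> cases c <;> simp_all

/-- Colours in the glued map. -/
def glueColour (P Q : PointedMap) : P.Rest ⊕ Q.Rest → Colour :=
  Sum.elim (fun x => P.M.colour x.1) (fun y => Q.M.colour y.1)

theorem glueColour_half (P Q : PointedMap) (hc : P.M.vertColour P.τ ≠ Q.M.vertColour Q.τ)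
    (β : Matching P Q) (x : P.Rest) :
    glueColour P Q (glueHalf P Q β x) ≠ P.M.colour x.1 := by
  by_cases h : P.M.vert (P.M.opp x.1) = P.τ
  · rw [glueHalf_stem P Q β x h]
    simp only [glueColour, Sum.elim_inr]
    set d := β ⟨P.M.opp x.1, h⟩ with hd
    have h1 : P.M.colour (P.M.opp x.1) = P.M.vertColour P.τ := congrArg P.M.vertColour h
    have h2 : Q.M.colour d.1 = Q.M.vertColour Q.τ := congrArg Q.M.vertColour d.2
    have h3 := Q.M.colour_opp d.1
    have h4 := P.M.colour_opp x.1
    rw [h1] at h4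
    rw [h2] at h3
    intro h5
    rw [h5] at h3
    exact hc (colour_eq_of_ne h4 h3)
  · rw [glueHalf_inner P Q β x h]
    exact P.M.colour_opp x.1

/-- Delete the marked vertices of `P` and `Q`, and glue the resulting stems along `β`.
The result need not be planar. -/
noncomputable def glue (P Q : PointedMap) (hc : P.M.vertColour P.τ ≠ Q.M.vertColour Q.τ)
    (β : Matching P Q) : RibbonGraph where
  Dart := P.Rest ⊕ Q.Rest
  finite := inferInstance
  rot := Equiv.sumCongr
    (P.M.rot.subtypePerm (p := fun d => P.M.vert d ≠ P.τ) (fun d => by rw [P.M.vert_rot]))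
    (Q.M.rot.subtypePerm (p := fun d => Q.M.vert d ≠ Q.τ) (fun d => by rw [Q.M.vert_rot]))
  opp := (glueOpp_involutive P Q β).toPerm
  opp_opp := glueOpp_involutive P Q β
  colour := glueColour P Q
  colour_rot := by
    rintro (x | y)
    · exact P.M.colour_rot x.1
    · exact Q.M.colour_rot y.1
  colour_opp := by
    rintro (x | y)
    · exact glueColour_half P Q hc β x
    · have h := glueColour_half Q P hc.symm β.symm y
      have h2 : ∀ z : Q.Rest ⊕ P.Rest, glueColour P Q z.swap = glueColour Q P z := by
        rintro (z | z) <;> rfl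
      change glueColour P Q (glueHalf Q P β.symm y).swap ≠ Q.M.colour y.1
      rwa [h2]

theorem glue_vert_ne (P Q : PointedMap) (hc : P.M.vertColour P.τ ≠ Q.M.vertColour Q.τ)
    (β : Matching P Q) (x : P.Rest) (y : Q.Rest) :
    (glue P Q hc β).vert (Sum.inl x) ≠ (glue P Q hc β).vert (Sum.inr y) := by
  intro h
  have hl : ∀ z : P.Rest ⊕ Q.Rest, Sum.isLeft ((glue P Q hc β).rot z) = z.isLeft := by
    rintro (z | z) <;> rfl
  have h2 := (glue P Q hc β).eq_of_sameCycle
    (fun z : P.Rest ⊕ Q.Rest => z.isLeft) hl ((RibbonGraph.vert_eq_iff _ _ _).1 h)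
  exact Bool.noConfusion h2

/-- The glued map, when it is planar, rooted at the root corners of `P` and `Q`. -/
noncomputable def glueMap (P Q : PointedMap) (hc : P.M.vertColour P.τ ≠ Q.M.vertColour Q.τ)
    (β : Matching P Q) (h : (glue P Q hc β).IsPlanarMap) : DoublyRootedMap where
  M := glue P Q hc β
  planar := h
  corner₁ := Sum.inl ⟨P.corner, P.root_ne⟩
  corner₂ := Sum.inr ⟨Q.corner, Q.root_ne⟩
  root_ne := glue_vert_ne P Q hc β _ _

end Glue

theorem trumpet_cornet_colour {k : ℕ} (t : Trumpet k) (c : Cornet k) :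
    t.1.M.vertColour t.1.τ ≠ c.1.M.vertColour c.1.τ := by
  rw [t.2.1.2, c.2.1.2]
  exact Colour.noConfusion

/-- The matchings of the `k` stems of a d-trumpet with the `k` stems of a d-cornet for which the
glued map is planar. -/
def PlanarMatching {k : ℕ} (t : Trumpet k) (c : Cornet k) : Type :=
  {β : Matching t.1 c.1 // (glue t.1 c.1 (trumpet_cornet_colour t c) β).IsPlanarMap}

/-- The doubly rooted planar map obtained by regluing a d-trumpet and a d-cornet. -/
noncomputable def reglue {k : ℕ} (t : Trumpet k) (c : Cornet k) (β : PlanarMatching t c) :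
    DoublyRootedMap :=
  glueMap t.1 c.1 (trumpet_cornet_colour t c) β.1 β.2

/-! Cuts. Weight is submodular, and black cuts are stable under union and intersection. Minimal
black cuts are therefore stable under intersection, so the least one, `Smin`, is itself minimal
(`Smin_mem_minimalBlackCuts`). By `IsPiece.exists_cut_equiv`, the cuts of the two pieces along `S₀`
are the cuts of the map containing `S₀` and, after complementation and a change of colour, those
contained in `S₀`. This makes the pieces along `Smin` a d-trumpet and a d-cornet. Conversely, if the
pieces along `S₀` are of these types, submodularity applied to `S` and `S₀` bounds the weight of an
arbitrary black cut `S` below by `k`, and equality forces `S₀ ⊆ S`; hence `S₀ = Smin`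
(`Smin_eq_of_isPiece`).

Planarity. Deleting a marked vertex leaves a map whose involution has fixed points, the stems. When
connected maps `X` and `Y` are glued along `k ≥ 1` stems, the Euler defect of the result is a sum of
five nonnegative terms: the defects of `X` and `Y`, the excess over one of the number of faces
carrying stems on each side, and `k` minus the number of newly formed faces. The last term vanishes
exactly when the matching reverses the cyclic orders of the stems (`Gluing.isPlanarMap_iff`).
Minimal cuts have connected sides, so the criterion applies here. Order-reversing matchings between
two `k`-cycles form a set of `k` elements (`card_semiconj`), and the cyclic order around a new
vertex `τ` is forced by planarity, which makes pieces exist and be unique up to isomorphism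
(`exists_isPiece`, `IsPiece.equivalent`).

Counting. Preimages of a pair are the planar regluings (`cutsInto_iff`). Distinct matchings give
non-isomorphic rooted maps: an isomorphism fixing both root corners is the identity on each
connected side, hence respects the matching (`matching_eq_of_iso`). So there are exactly `k`
preimages, with no symmetry factor. -/

/-! ### Counting the cycles of a permutation -/

section Cycles

open Equiv Equiv.Perm

variable {α β : Type*}

/-- The number of cycles of a permutation, fixed points included. -/
noncomputable def numCycles (f : Perm α) : ℕ := Nat.card (Quotient (SameCycle.setoid f))

/-- The cycle relation is the least equivalence relation linking each point to its image; this
replaces later inductions on integer powers. -/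
theorem Setoid.rel_of_sameCycle (s : Setoid α) (f : Perm α) (h : ∀ x, s x (f x)) {x y : α}
    (hxy : SameCycle f x y) : s x y := by
  obtain ⟨i, rfl⟩ := hxy
  induction i with
  | zero => simp
  | succ n ih => rw [add_comm, zpow_add, zpow_one, mul_apply]; exact s.trans ih (h _)
  | pred n ih =>
    refine s.trans ih (s.symm ?_)
    have := h ((f ^ (-(n : ℤ) - 1)) x)
    rwa [← mul_apply, ← zpow_one_add, add_sub_cancel] at this

theorem Equiv.Perm.SameCycle.map {f : Perm α} {g : Perm β} (e : α → β)
    (h : ∀ x, SameCycle g (e x) (e (f x))) {x y : α} (hxy : SameCycle f x y) :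
    SameCycle g (e x) (e y) :=
  ((SameCycle.setoid g).comap e).rel_of_sameCycle f h hxy

/-- By finiteness, a cycle is traversed by nonnegative powers alone, so closure under `f` suffices
without closure under `f⁻¹`. -/
theorem Equiv.Perm.SameCycle.mem_of_closed [Finite α] {f : Perm α} {U : Set α}
    (h : ∀ x ∈ U, f x ∈ U) {x y : α} (hxy : SameCycle f x y) (hx : x ∈ U) : y ∈ U := by
  obtain ⟨n, rfl⟩ := hxy.exists_nat_pow_eq
  induction n with
  | zero => exact hx
  | succ n ih => rw [pow_succ', mul_apply]; exact h _ (ih ⟨n, by simp⟩)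

theorem Equiv.Perm.mem_iff_of_closed [Finite α] {f : Perm α} {U : Set α}
    (h : ∀ x ∈ U, f x ∈ U) (x : α) : f x ∈ U ↔ x ∈ U :=
  ⟨fun hx => SameCycle.mem_of_closed h (sameCycle_apply_left.2 SameCycle.rfl) hx, h x⟩

theorem numCycles_congr {f : Perm α} {g : Perm β} (e : α ≃ β) (h : ∀ x, e (f x) = g (e x)) :
    numCycles f = numCycles g := by
  refine Nat.card_congr (Quotient.congr e fun x y => ?_)
  refine ⟨SameCycle.map e fun x => ?_, fun hxy => ?_⟩
  · rw [h]; exact sameCycle_apply_right.2 SameCycle.rfl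
  · have := SameCycle.map (f := g) (g := f) e.symm (fun x => ?_) hxy
    · change SameCycle f x y
      simpa using this
    · rw [show e.symm (g x) = f (e.symm x) by rw [Equiv.symm_apply_eq, h, apply_symm_apply]]
      exact sameCycle_apply_right.2 SameCycle.rfl

theorem numCycles_one : numCycles (1 : Perm α) = Nat.card α := by
  refine (Nat.card_congr (Equiv.ofBijective (fun x => Quotient.mk _ x) ⟨fun x y h => ?_, ?_⟩)).symm
  · exact sameCycle_one.1 (Quotient.exact h)
  · exact Quotient.mk_surjective

theorem numCycles_pos [Finite α] [Nonempty α] (f : Perm α) : 0 < numCycles f :=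
  have : Nonempty (Quotient (SameCycle.setoid f)) := ⟨Quotient.mk _ (Classical.arbitrary α)⟩
  Nat.card_pos

theorem numCycles_eq_one_iff [Nonempty α] (f : Perm α) :
    numCycles f = 1 ↔ ∀ x y, SameCycle f x y := by
  unfold numCycles
  rw [Nat.card_eq_one_iff_unique]
  constructor
  · rintro ⟨h, -⟩ x y
    exact Quotient.exact (h.elim (Quotient.mk _ x) (Quotient.mk _ y))
  · intro h
    refine ⟨⟨?_⟩, ⟨Quotient.mk _ (Classical.arbitrary α)⟩⟩
    rintro ⟨x⟩ ⟨y⟩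
    exact Quotient.sound (h x y)

theorem sumCongr_zpow (f : Perm α) (g : Perm β) (i : ℤ) :
    Perm.sumCongr f g ^ i = Perm.sumCongr (f ^ i) (g ^ i) :=
  (map_zpow (sumCongrHom α β) (f, g) i).symm

theorem numCycles_sumCongr [Finite α] [Finite β] (f : Perm α) (g : Perm β) :
    numCycles (Perm.sumCongr f g) = numCycles f + numCycles g := by
  have hl : ∀ x y, SameCycle f x y ↔ SameCycle (Perm.sumCongr f g) (Sum.inl x) (Sum.inl y) := by
    intro x y
    refine ⟨SameCycle.map Sum.inl fun x => ⟨1, rfl⟩, fun ⟨i, hi⟩ => ⟨i, ?_⟩⟩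
    rw [sumCongr_zpow] at hi
    exact Sum.inl_injective hi
  have hr : ∀ x y, SameCycle g x y ↔ SameCycle (Perm.sumCongr f g) (Sum.inr x) (Sum.inr y) := by
    intro x y
    refine ⟨SameCycle.map Sum.inr fun x => ⟨1, rfl⟩, fun ⟨i, hi⟩ => ⟨i, ?_⟩⟩
    rw [sumCongr_zpow] at hi
    exact Sum.inr_injective hi
  have hlr : ∀ x y, ¬ SameCycle (Perm.sumCongr f g) (Sum.inl x) (Sum.inr y) := by
    rintro x y ⟨i, hi⟩
    rw [sumCongr_zpow] at hi
    exact Sum.inl_ne_inr hi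
  unfold numCycles
  rw [← Nat.card_sum]
  symm
  refine Nat.card_congr (Equiv.ofBijective (Sum.elim
    (Quotient.map' (s₁ := SameCycle.setoid f) (s₂ := SameCycle.setoid (Perm.sumCongr f g))
      Sum.inl fun x y h => (hl x y).1 h)
    (Quotient.map' (s₁ := SameCycle.setoid g) (s₂ := SameCycle.setoid (Perm.sumCongr f g))
      Sum.inr fun x y h => (hr x y).1 h)) ⟨?_, ?_⟩)
  · rintro (⟨⟨x⟩⟩ | ⟨⟨x⟩⟩) (⟨⟨y⟩⟩ | ⟨⟨y⟩⟩) h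
    · exact congrArg Sum.inl (Quotient.sound ((hl x y).2 (Quotient.exact h)))
    · exact (hlr x y (Quotient.exact h)).elim
    · exact (hlr y x (Quotient.exact h).symm).elim
    · exact congrArg Sum.inr (Quotient.sound ((hr x y).2 (Quotient.exact h)))
  · rintro ⟨x | x⟩
    · exact ⟨Sum.inl (Quotient.mk _ x), rfl⟩
    · exact ⟨Sum.inr (Quotient.mk _ x), rfl⟩

/-! ### Permutations without fixed points -/

section FixedPointFree

variable [Finite α] (f : Perm α)

theorem card_eq_sum_card_cycle [Fintype (Quotient (SameCycle.setoid f))] :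
    Nat.card α = ∑ q : Quotient (SameCycle.setoid f),
      Nat.card {x : α // Quotient.mk (SameCycle.setoid f) x = q} := by
  rw [← Nat.card_sigma]
  exact Nat.card_congr (Equiv.sigmaFiberEquiv _).symm

theorem two_le_card_cycle (hf : ∀ x, f x ≠ x) (q : Quotient (SameCycle.setoid f)) :
    2 ≤ Nat.card {x : α // Quotient.mk (SameCycle.setoid f) x = q} := by
  obtain ⟨x, rfl⟩ := Quotient.exists_rep q
  refine Nat.succ_le_of_lt (Finite.one_lt_card_iff_nontrivial.2
    ⟨⟨f x, Quotient.sound (sameCycle_apply_left.2 SameCycle.rfl)⟩, ⟨x, rfl⟩, fun h => hf x ?_⟩)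
  exact congrArg Subtype.val h

theorem card_cycle_eq_two_iff (hf : ∀ x, f x ≠ x) (x : α) :
    Nat.card {y : α // Quotient.mk (SameCycle.setoid f) y = Quotient.mk _ x} = 2 ↔
      f (f x) = x := by
  set T := {y : α // Quotient.mk (SameCycle.setoid f) y = Quotient.mk _ x}
  have h0 : ∀ y, SameCycle f x y → Quotient.mk (SameCycle.setoid f) y = Quotient.mk _ x :=
    fun y h => Quotient.sound h.symm
  have h1 : SameCycle f x (f x) := sameCycle_apply_right.2 SameCycle.rfl
  have h2 : SameCycle f x (f (f x)) := sameCycle_apply_right.2 h1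
  constructor
  · intro h
    rw [Nat.card_eq_two_iff] at h
    obtain ⟨a, b, -, hu⟩ := h
    -- Otherwise `x`, `f x` and `f (f x)` would be three distinct points of a two-point cycle.
    by_contra hne
    have ha : (⟨x, rfl⟩ : T) ∈ ({a, b} : Set T) := by rw [hu]; trivial
    have hb : (⟨f x, h0 _ h1⟩ : T) ∈ ({a, b} : Set T) := by rw [hu]; trivial
    have hc : (⟨f (f x), h0 _ h2⟩ : T) ∈ ({a, b} : Set T) := by rw [hu]; trivial
    have n1 := hf x
    have n2 := hf (f x)
    simp only [Set.mem_insert_iff, Set.mem_singleton_iff] at ha hb hc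
    have e1 : (⟨f x, h0 _ h1⟩ : T) ≠ ⟨x, rfl⟩ := fun h => n1 (congrArg Subtype.val h)
    have e2 : (⟨f (f x), h0 _ h2⟩ : T) ≠ ⟨f x, h0 _ h1⟩ := fun h => n2 (congrArg Subtype.val h)
    have e3 : (⟨f (f x), h0 _ h2⟩ : T) ≠ ⟨x, rfl⟩ := fun h => hne (congrArg Subtype.val h)
    grind
  · intro h
    rw [Nat.card_eq_two_iff]
    refine ⟨⟨x, rfl⟩, ⟨f x, h0 _ h1⟩, fun h => hf x (congrArg Subtype.val h).symm, ?_⟩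
    ext ⟨y, hy⟩
    simp only [Set.mem_insert_iff, Set.mem_singleton_iff, Set.mem_univ, iff_true]
    have hxy : SameCycle f x y := (Quotient.exact hy).symm
    rw [Subtype.mk.injEq, Subtype.mk.injEq]
    refine SameCycle.mem_of_closed (U := {z | z = x ∨ z = f x}) ?_ hxy (Or.inl rfl)
    rintro z (rfl | rfl)
    · exact Or.inr rfl
    · exact Or.inl h

theorem two_mul_numCycles_le (hf : ∀ x, f x ≠ x) : 2 * numCycles f ≤ Nat.card α := by
  have := Fintype.ofFinite (Quotient (SameCycle.setoid f))
  rw [card_eq_sum_card_cycle f, numCycles, Nat.card_eq_fintype_card, mul_comm,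
    ← smul_eq_mul, ← Finset.card_univ, ← Finset.sum_const]
  exact Finset.sum_le_sum fun q _ => two_le_card_cycle f hf q

/-- Every cycle has at least two points, so equality of the sums forces each to have exactly two. -/
theorem two_mul_numCycles_eq_iff (hf : ∀ x, f x ≠ x) :
    2 * numCycles f = Nat.card α ↔ ∀ x, f (f x) = x := by
  have := Fintype.ofFinite (Quotient (SameCycle.setoid f))
  rw [card_eq_sum_card_cycle f, numCycles, Nat.card_eq_fintype_card, mul_comm,
    ← smul_eq_mul, ← Finset.card_univ, ← Finset.sum_const,
    Finset.sum_eq_sum_iff_of_le fun q _ => two_le_card_cycle f hf q]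
  constructor
  · exact fun h x => (card_cycle_eq_two_iff f hf x).1 (h _ (Finset.mem_univ _)).symm
  · rintro h ⟨x⟩ -
    exact ((card_cycle_eq_two_iff f hf x).2 (h x)).symm

end FixedPointFree

/-! ### First return permutations -/

section FirstReturn

/-- If `n ≤ m`, cancelling powers puts `x` on the orbit of `y` at time `m - n`; a positive time
would be a return of `y` to `p` that is too early. This is the injectivity of the first return map.
-/
theorem eq_of_first_return {f : Perm α} {p : α → Prop} {x y : α} {n m : ℕ}
    (hx : p x) (hy : p y) (hn : ∀ j < n, ¬ p ((f ^ (j + 1)) x))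
    (hm : ∀ j < m, ¬ p ((f ^ (j + 1)) y)) (h : (f ^ (n + 1)) x = (f ^ (m + 1)) y) : x = y := by
  wlog hnm : n ≤ m generalizing x y n m
  · exact (this hy hx hm hn h.symm (by omega)).symm
  obtain ⟨d, rfl⟩ := Nat.exists_eq_add_of_le hnm
  rw [show n + d + 1 = (n + 1) + d by ring, pow_add f (n + 1) d, mul_apply] at h
  have h := (f ^ (n + 1)).injective h
  cases d with
  | zero => simpa using h
  | succ d => exact (hm d (by omega) (h ▸ hx)).elim

/-- Since `g` moves only points of `p`, it acts once at the start, and the orbit then follows `f`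
until it meets `p` again. -/
theorem mul_pow_apply_of_fixes {f g : Perm α} {p : α → Prop} (hg : ∀ x, ¬ p x → g x = x)
    (x : α) (n : ℕ) (hn : ∀ j < n, ¬ p ((f ^ (j + 1)) (g x))) :
    ((f * g) ^ (n + 1)) x = (f ^ (n + 1)) (g x) := by
  induction n with
  | zero => simp
  | succ n ih =>
    rw [pow_succ', mul_apply, ih fun j hj => hn j (by omega), mul_apply, hg _ (hn n (by omega)),
      ← mul_apply, ← pow_succ']

variable [Finite α]

theorem exists_pow_succ_mem (f : Perm α) {p : α → Prop} {x : α} (hx : p x) :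
    ∃ n, p ((f ^ (n + 1)) x) := by
  have := isOfFinOrder_of_finite f
  refine ⟨orderOf f - 1, ?_⟩
  rwa [Nat.sub_add_cancel (orderOf_pos f), pow_orderOf_eq_one]

/-- Some point of the orbit after `x` satisfies `p`, and `n` is the first such index. -/
theorem exists_first_return (f : Perm α) {p : α → Prop} {x : α} (hx : p x) :
    ∃ n, p ((f ^ (n + 1)) x) ∧ ∀ j < n, ¬ p ((f ^ (j + 1)) x) := by
  classical
  have h := exists_pow_succ_mem f hx
  exact ⟨Nat.find h, Nat.find_spec h, fun j hj => Nat.find_min h hj⟩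

/-- The number of steps before the orbit of `x` returns to `p`, minus one. -/
noncomputable def returnTime (f : Perm α) (p : α → Prop) (x : {x // p x}) : ℕ :=
  (exists_first_return f x.2).choose

/-- The permutation induced by `f` on `{x // p x}`: each point is sent to the next point of its
orbit satisfying `p`. -/
noncomputable def firstReturn (f : Perm α) (p : α → Prop) : Perm {x // p x} :=
  Equiv.ofBijective
    (fun x => ⟨(f ^ (returnTime f p x + 1)) x.1, (exists_first_return f x.2).choose_spec.1⟩)
    (Finite.injective_iff_bijective.1 fun x y h => Subtype.ext <|
      eq_of_first_return x.2 y.2 (exists_first_return f x.2).choose_spec.2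
        (exists_first_return f y.2).choose_spec.2 (congrArg Subtype.val h))

theorem firstReturn_spec (f : Perm α) (p : α → Prop) (x : {x // p x}) :
    ∃ n, (firstReturn f p x).1 = (f ^ (n + 1)) x.1 ∧ ∀ j < n, ¬ p ((f ^ (j + 1)) x.1) :=
  ⟨returnTime f p x, rfl, (exists_first_return f x.2).choose_spec.2⟩

theorem firstReturn_eq {f : Perm α} {p : α → Prop} {x y : {x // p x}} (n : ℕ)
    (h : y.1 = (f ^ (n + 1)) x.1) (hn : ∀ j < n, ¬ p ((f ^ (j + 1)) x.1)) :
    firstReturn f p x = y := by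
  obtain ⟨m, hm, hm'⟩ := firstReturn_spec f p x
  have : m = n := by
    rcases lt_trichotomy m n with h1 | h1 | h1
    · exact (hn m h1 (hm ▸ (firstReturn f p x).2)).elim
    · exact h1
    · exact (hm' n h1 (h ▸ y.2)).elim
  subst this
  exact Subtype.ext (hm.trans h.symm)

theorem firstReturn_sameCycle_iff (f : Perm α) (p : α → Prop) (x y : {x // p x}) :
    SameCycle (firstReturn f p) x y ↔ SameCycle f x.1 y.1 := by
  constructor
  · refine SameCycle.map Subtype.val fun x => ?_
    obtain ⟨n, hn, -⟩ := firstReturn_spec f p x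
    rw [hn]
    exact sameCycle_pow_right.2 SameCycle.rfl
  · intro h
    obtain ⟨n, hn⟩ := h.exists_nat_pow_eq
    induction n using Nat.strong_induction_on generalizing x with
    | _ n ih =>
      rcases Nat.eq_zero_or_pos n with rfl | hpos
      · exact (Subtype.ext hn : x = y).sameCycle _
      · obtain ⟨m, hm, hm'⟩ := firstReturn_spec f p x
        -- The target `y` satisfies `p`, so the first return occurs no later than the arrival at
        -- `y`; induct on the remaining number of steps.
        have hmn : m + 1 ≤ n := by
          by_contra hlt
          refine hm' (n - 1) (by omega) ?_
          rw [Nat.sub_add_cancel hpos, hn]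
          exact y.2
        rw [← sameCycle_apply_left]
        have h2 : (f ^ (n - (m + 1))) (firstReturn f p x).1 = y.1 := by
          rw [hm, ← mul_apply, ← pow_add, Nat.sub_add_cancel hmn, hn]
        exact ih _ (by omega) _ ⟨(n - (m + 1) : ℕ), by rw [zpow_natCast]; exact h2⟩ h2

/-- The cycles of `f` are those of its first return permutation, and those avoiding `p`. -/
theorem numCycles_eq_firstReturn_add (f : Perm α) (p N : α → Prop) (hN : ∀ x, N (f x) ↔ N x)
    (hNp : ∀ x, N x → ¬ p x) (hNp' : ∀ x, ¬ N x → ∃ y, SameCycle f x y ∧ p y) :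
    numCycles f = numCycles (firstReturn f p) + numCycles (f.subtypePerm hN) := by
  have hN' : ∀ {x y}, SameCycle f x y → N x → N y := fun h =>
    SameCycle.mem_of_closed (U := {x | N x}) (fun x hx => (hN x).2 hx) h
  unfold numCycles
  rw [← Nat.card_sum]
  symm
  refine Nat.card_congr (Equiv.ofBijective (Sum.elim
    (Quotient.map' (s₁ := SameCycle.setoid (firstReturn f p)) (s₂ := SameCycle.setoid f)
      Subtype.val fun x y h => (firstReturn_sameCycle_iff f p x y).1 h)
    (Quotient.map' (s₁ := SameCycle.setoid (f.subtypePerm hN)) (s₂ := SameCycle.setoid f)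
      Subtype.val fun x y h => sameCycle_subtypePerm.1 h)) ⟨?_, ?_⟩)
  · rintro (⟨⟨x⟩⟩ | ⟨⟨x⟩⟩) (⟨⟨y⟩⟩ | ⟨⟨y⟩⟩) h
    · exact congrArg Sum.inl (Quotient.sound
        ((firstReturn_sameCycle_iff f p x y).2 (Quotient.exact h)))
    · exact (hNp _ (hN' (Quotient.exact h).symm y.2) x.2).elim
    · exact (hNp _ (hN' (Quotient.exact h) x.2) y.2).elim
    · exact congrArg Sum.inr (Quotient.sound (sameCycle_subtypePerm.2 (Quotient.exact h)))
  · rintro ⟨x⟩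
    by_cases hx : N x
    · exact ⟨Sum.inr (Quotient.mk _ ⟨x, hx⟩), rfl⟩
    · obtain ⟨y, hxy, hy⟩ := hNp' x hx
      exact ⟨Sum.inl (Quotient.mk _ ⟨y, hy⟩), Quotient.sound hxy.symm⟩

/-- A perturbation supported on `p` leaves the cycles avoiding `p` alone and multiplies the first
return permutation by its restriction to `p`. The additive form avoids subtraction of naturals. -/
theorem numCycles_mul_add {f g : Perm α} {p : α → Prop} (hg : ∀ x, ¬ p x → g x = x)
    (hp : ∀ x, p (g x) ↔ p x) :
    numCycles (f * g) + numCycles (firstReturn f p) =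
      numCycles f + numCycles (firstReturn f p * g.subtypePerm hp) := by
  have hret : firstReturn (f * g) p = firstReturn f p * g.subtypePerm hp := by
    ext1 x
    obtain ⟨n, hn, hn'⟩ := firstReturn_spec f p (g.subtypePerm hp x)
    refine firstReturn_eq n ?_ fun j hj => ?_
    · rw [mul_pow_apply_of_fixes hg _ _ hn', mul_apply]
      exact hn
    · rw [mul_pow_apply_of_fixes hg _ _ fun i hi => hn' i (by omega)]
      exact hn' j hj
  -- The points whose `f`-cycle misses `p`; there `f * g` and `f` coincide.
  set N : α → Prop := fun x => ∀ y, SameCycle f x y → ¬ p y with hNdef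
  have hNp : ∀ x, N x → ¬ p x := fun x hx => hx x SameCycle.rfl
  have hN1 : ∀ x, N (f x) ↔ N x := fun x => by simp only [hNdef, sameCycle_apply_left]
  have hN2 : ∀ x, N ((f * g) x) ↔ N x := by
    intro x
    rw [mul_apply, hN1]
    by_cases hx : p x
    · exact iff_of_false (fun h => hNp _ h ((hp x).2 hx)) fun h => hNp _ h hx
    · rw [hg x hx]
  have h1 := numCycles_eq_firstReturn_add f p N hN1 hNp (by simp [hNdef])
  have h2 := numCycles_eq_firstReturn_add (f * g) p N hN2 hNp (by
    intro x hx
    by_cases hpx : p x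
    · exact ⟨x, SameCycle.rfl, hpx⟩
    simp only [hNdef, not_forall, not_not, exists_prop] at hx
    obtain ⟨y, hxy, hy⟩ := hx
    obtain ⟨n, hn⟩ := hxy.exists_nat_pow_eq
    classical
    have hex : ∃ n, p ((f ^ (n + 1)) x) := by
      cases n with
      | zero => exact (hpx ((show x = y from hn) ▸ hy)).elim
      | succ n => exact ⟨n, hn ▸ hy⟩
    refine ⟨_, ?_, Nat.find_spec hex⟩
    have := mul_pow_apply_of_fixes (f := f) hg x (Nat.find hex) (fun j hj => by
      rw [hg x hpx]; exact Nat.find_min hex hj)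
    rw [hg x hpx] at this
    rw [← this]
    exact sameCycle_pow_right.2 SameCycle.rfl)
  have h3 : numCycles (f.subtypePerm hN1) = numCycles ((f * g).subtypePerm hN2) := by
    congr 1
    ext x
    simp [hg x.1 (hNp _ x.2)]
  rw [h1, h2, hret, h3]
  omega

end FirstReturn

end Cycles

/-! ### The Euler inequality for a permutation and an involution -/

section Euler

open Equiv Equiv.Perm

variable {α : Type*}

/-- The equivalence relation obtained from `r` by identifying the classes of `a` and `b`. -/
def mergeSetoid (r : Setoid α) (a b : α) : Setoid α where
  r x y := r x y ∨ (r x a ∧ r y b) ∨ (r x b ∧ r y a)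
  iseqv :=
    { refl := fun x => Or.inl (r.refl x)
      symm := by
        rintro x y (h | h | h)
        · exact Or.inl (r.symm h)
        · exact Or.inr (Or.inr h.symm)
        · exact Or.inr (Or.inl h.symm)
      trans := by
        have ht : ∀ {x y z}, r x y → r y z → r x z := r.trans
        have hs : ∀ {x y}, r x y → r y x := r.symm
        rintro x y z (h | ⟨h1, h2⟩ | ⟨h1, h2⟩) (h' | ⟨h1', h2'⟩ | ⟨h1', h2'⟩)
        · exact Or.inl (ht h h')
        · exact Or.inr (Or.inl ⟨ht h h1', h2'⟩)
        · exact Or.inr (Or.inr ⟨ht h h1', h2'⟩)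
        · exact Or.inr (Or.inl ⟨h1, ht (hs h') h2⟩)
        · exact Or.inr (Or.inl ⟨h1, h2'⟩)
        · exact Or.inl (ht h1 (hs h2'))
        · exact Or.inr (Or.inr ⟨h1, ht (hs h') h2⟩)
        · exact Or.inl (ht h1 (hs h2'))
        · exact Or.inr (Or.inr ⟨h1, h2'⟩) }

theorem le_mergeSetoid (r : Setoid α) (a b : α) : r ≤ mergeSetoid r a b := fun _ _ => Or.inl

theorem mergeSetoid_rel (r : Setoid α) (a b : α) : mergeSetoid r a b a b :=
  Or.inr (Or.inl ⟨r.refl a, r.refl b⟩)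

theorem mergeSetoid_le {r s : Setoid α} {a b : α} (h : r ≤ s) (hab : s a b) :
    mergeSetoid r a b ≤ s := by
  rintro x y (hxy | ⟨h1, h2⟩ | ⟨h1, h2⟩)
  · exact h hxy
  · exact s.trans (h h1) (s.trans hab (s.symm (h h2)))
  · exact s.trans (h h1) (s.trans (s.symm hab) (s.symm (h h2)))

theorem sameCycle_setoid_mul_swap_le [DecidableEq α] (f : Perm α) {a b : α} {s : Setoid α}
    (hs : SameCycle.setoid f ≤ s) (hab : s a b) : SameCycle.setoid (f * swap a b) ≤ s := by
  intro x y hxy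
  refine s.rel_of_sameCycle _ (fun x => ?_) hxy
  have h1 : s (swap a b x) ((f * swap a b) x) := hs ⟨1, rfl⟩
  refine s.trans ?_ h1
  by_cases hxa : x = a
  · subst hxa; rwa [swap_apply_left]
  by_cases hxb : x = b
  · subst hxb; rw [swap_apply_right]; exact s.symm hab
  · rw [swap_apply_of_ne_of_ne hxa hxb]

variable [Finite α]

theorem card_quotient_le_of_le {r s : Setoid α} (h : r ≤ s) :
    Nat.card (Quotient s) ≤ Nat.card (Quotient r) :=
  Nat.card_le_card_of_surjective (Quotient.map' (s₁ := r) (s₂ := s) id fun _ _ h' => h h')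
    (by rintro ⟨x⟩; exact ⟨Quotient.mk _ x, rfl⟩)

theorem card_quotient_lt_of_le {r s : Setoid α} (h : r ≤ s) {a b : α} (hs : s a b)
    (hr : ¬ r a b) : Nat.card (Quotient s) + 1 ≤ Nat.card (Quotient r) := by
  have := Fintype.ofFinite (Quotient r)
  have := Fintype.ofFinite (Quotient s)
  rw [Nat.card_eq_fintype_card, Nat.card_eq_fintype_card]
  refine Fintype.card_lt_of_surjective_not_injective
    (Quotient.map' (s₁ := r) (s₂ := s) id fun _ _ h' => h h')
    (by rintro ⟨x⟩; exact ⟨Quotient.mk _ x, rfl⟩) fun hinj => hr ?_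
  have h1 : (Quotient.mk r a) = Quotient.mk r b := hinj (Quotient.sound hs)
  exact Quotient.exact h1

theorem card_quotient_le_mergeSetoid (r : Setoid α) (a b : α) :
    Nat.card (Quotient r) ≤ Nat.card (Quotient (mergeSetoid r a b)) + 1 := by
  classical
  rw [← Finite.card_option]
  -- Only the classes of `a` and `b` become equal, so sending the class of `a` to `none` restores
  -- injectivity.
  refine Nat.card_le_card_of_injective (fun q : Quotient r =>
    if q = Quotient.mk r a then none else
      some (Quotient.map' (s₁ := r) (s₂ := mergeSetoid r a b) id
        (fun _ _ h' => le_mergeSetoid r a b h') q)) ?_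
  rintro ⟨x⟩ ⟨y⟩ h
  change (if Quotient.mk r x = Quotient.mk r a then none else _) =
    (if Quotient.mk r y = Quotient.mk r a then none else _) at h
  change Quotient.mk r x = Quotient.mk r y
  split_ifs at h with h1 h2 h2
  · rw [h1, h2]
  · have h3 : mergeSetoid r a b x y := Quotient.exact (Option.some_injective _ h)
    rcases h3 with h3 | h3 | h3
    · exact Quotient.sound h3
    · exact (h1 (Quotient.sound h3.1)).elim
    · exact (h2 (Quotient.sound h3.2)).elim

/-- From `a` the product jumps to `f b` and then follows the `f`-cycle of `b`. It cannot meet `a`,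
which lies in another cycle, so it runs until it reaches `b`. -/
theorem sameCycle_mul_swap [DecidableEq α] {f : Perm α} {a b : α} (h : ¬ SameCycle f a b) :
    SameCycle (f * swap a b) a b := by
  by_contra hab
  have key : ∀ n : ℕ, SameCycle (f * swap a b) a ((f ^ (n + 1)) b) := by
    intro n
    induction n with
    | zero => exact ⟨1, by simp⟩
    | succ n ih =>
      have h1 : (f ^ (n + 1)) b ≠ a := fun h' =>
        h (h' ▸ sameCycle_pow_left.2 SameCycle.rfl)
      have h2 : (f ^ (n + 1)) b ≠ b := fun h' => hab (by rwa [h'] at ih)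
      have h3 : (f ^ (n + 1 + 1)) b = (f * swap a b) ((f ^ (n + 1)) b) := by
        rw [mul_apply, swap_apply_of_ne_of_ne h1 h2, pow_succ', mul_apply]
      rw [h3]
      exact sameCycle_apply_right.2 ih
  obtain ⟨n, hn⟩ := exists_pow_succ_mem f (p := fun x => x = b) (x := b) rfl
  have h := key n
  rw [hn] at h
  exact hab h

theorem numCycles_mul_swap_le [DecidableEq α] (f : Perm α) (a b : α) :
    numCycles (f * swap a b) ≤ numCycles f + 1 := by
  refine (card_quotient_le_mergeSetoid _ a b).trans (Nat.add_le_add_right ?_ 1)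
  refine card_quotient_le_of_le ?_
  have := sameCycle_setoid_mul_swap_le (f * swap a b) (le_mergeSetoid _ a b)
    (mergeSetoid_rel _ a b)
  rwa [mul_assoc, swap_mul_self, mul_one] at this

theorem numCycles_mul_swap_add_one_le [DecidableEq α] {f : Perm α} {a b : α}
    (h : ¬ SameCycle f a b) : numCycles (f * swap a b) + 1 ≤ numCycles f := by
  refine card_quotient_lt_of_le ?_ (sameCycle_mul_swap h) h
  have := sameCycle_setoid_mul_swap_le (f * swap a b) le_rfl (sameCycle_mul_swap h)
  rwa [mul_assoc, swap_mul_self, mul_one] at this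

/-- The equivalence relation whose classes are the orbits of the group generated by `f`, `g`. -/
def orbitSetoid (f g : Perm α) : Setoid α := SameCycle.setoid f ⊔ SameCycle.setoid g

/-- Nonnegativity of the genus, component by component: vertices, edges and faces are the cycles of
`f`, `g` and `f * g`, with stems counted among the edges. The induction erases one edge at a time.
-/
theorem numCycles_add_le (f g : Perm α) (hg : ∀ x, g (g x) = x) :
    numCycles f + numCycles g + numCycles (f * g) ≤
      Nat.card α + 2 * Nat.card (Quotient (orbitSetoid f g)) := by
  classical
  induction hn : {x | g x ≠ x}.ncard using Nat.strong_induction_on generalizing g with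
  | _ n ih =>
  by_cases hg1 : g = 1
  · subst hg1
    have h1 : orbitSetoid f (1 : Perm α) = SameCycle.setoid f := by
      refine sup_eq_left.2 fun x y h => ?_
      rw [sameCycle_one.1 h]
    rw [h1, mul_one, numCycles_one]
    change _ ≤ Nat.card α + 2 * numCycles f
    omega
  obtain ⟨a, ha⟩ : ∃ a, g a ≠ a := by
    by_contra hne
    push Not at hne
    exact hg1 (Equiv.ext hne)
  set b := g a with hb
  -- Erasing the edge `{a, b}` turns its two half-edges into stems, so `g'` has one more cycle than
  -- `g`.
  set g' := g * swap a b with hg'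
  have hga : g' a = a := by rw [hg', mul_apply, swap_apply_left, hb, hg]
  have hgb : g' b = b := by rw [hg', mul_apply, swap_apply_right]
  have hgx : ∀ x, x ≠ a → x ≠ b → g' x = g x := fun x h1 h2 => by
    rw [hg', mul_apply, swap_apply_of_ne_of_ne h1 h2]
  have hgg : g = g' * swap a b := by rw [hg', mul_assoc, swap_mul_self, mul_one]
  have hg'2 : ∀ x, g' (g' x) = x := by
    intro x
    by_cases h1 : x = a
    · rw [h1, hga, hga]
    by_cases h2 : x = b
    · rw [h2, hgb, hgb]
    rw [hgx x h1 h2, hgx, hg]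
    · exact fun h => h2 (by rw [hb, ← h, hg])
    · exact fun h => h1 (g.injective h)
  have hlt : {x | g' x ≠ x}.ncard < n := by
    rw [← hn]
    refine Set.ncard_lt_ncard ⟨fun x hx => ?_, fun h => h (show g a ≠ a from ha) hga⟩
      (Set.toFinite _)
    have h1 : x ≠ a := fun h => hx (by rw [h, hga])
    have h2 : x ≠ b := fun h => hx (by rw [h, hgb])
    change g x ≠ x
    rw [← hgx x h1 h2]
    exact hx
  have key := ih _ hlt g' hg'2 rfl
  have hz : numCycles g + 1 ≤ numCycles g' := by
    have := numCycles_mul_swap_add_one_le (f := g') (a := a) (b := b)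
      fun h => ha (h.eq_of_left hga).symm
    rwa [← hgg] at this
  have hfg : f * g = f * g' * swap a b := by rw [mul_assoc, ← hgg]
  have hle : orbitSetoid f g ≤ mergeSetoid (orbitSetoid f g') a b := by
    refine sup_le (le_sup_left.trans (le_mergeSetoid _ _ _)) ?_
    have := sameCycle_setoid_mul_swap_le g' (a := a) (b := b)
      (le_sup_right.trans (le_mergeSetoid (orbitSetoid f g') a b)) (mergeSetoid_rel _ a b)
    rwa [← hgg] at this
  have hc := card_quotient_le_of_le hle
  have hc' := card_quotient_le_mergeSetoid (orbitSetoid f g') a b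
  -- If the edge joins points already connected, restoring it adds at most one face and keeps the
  -- components. Otherwise it joins two components, and two faces merge.
  by_cases hab : orbitSetoid f g' a b
  · have h1 := card_quotient_le_of_le (hle.trans (mergeSetoid_le le_rfl hab))
    have h2 := numCycles_mul_swap_le (f * g') a b
    rw [← hfg] at h2
    omega
  · have h2 := numCycles_mul_swap_add_one_le (f := f * g') (a := a) (b := b) fun h => hab ?_
    · rw [← hfg] at h2
      omega
    · refine (orbitSetoid f g').rel_of_sameCycle _ (fun x => ?_) h
      have h3 : orbitSetoid f g' x (g' x) :=
        (le_sup_right : _ ≤ orbitSetoid f g') (show SameCycle g' x (g' x) from ⟨1, rfl⟩)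
      have h4 : orbitSetoid f g' (g' x) (f (g' x)) :=
        (le_sup_left : _ ≤ orbitSetoid f g') (show SameCycle f _ (f (g' x)) from ⟨1, rfl⟩)
      exact (orbitSetoid f g').trans h3 h4

end Euler

/-! ### Gluing two permutations along part of their supports -/

section GluePerm

open Equiv Equiv.Perm

variable {α β : Type*} {p : α → Prop} {q : β → Prop}

/-- The involution of `{x // p x} ⊕ {y // q y}` exchanging `s` and `γ s`. -/
def exchange (γ : {x // p x} ≃ {y // q y}) : Perm ({x // p x} ⊕ {y // q y}) :=
  (sumComm _ _).trans (Equiv.sumCongr γ.symm γ)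

/-- `Equiv.subtypeSum` for a predicate given by its two components. -/
def sumSubtype (p : α → Prop) (q : β → Prop) :
    {x // p x} ⊕ {y // q y} ≃ {z : α ⊕ β // Sum.elim p q z} :=
  (subtypeSum (p := Sum.elim p q)).symm

theorem sumCongr_mul_exchange_ne (γ : {x // p x} ≃ {y // q y}) (f : Perm {x // p x})
    (g : Perm {y // q y}) (z) : (Perm.sumCongr f g * exchange γ) z ≠ z := by
  rcases z with s | t
  · exact fun h => Sum.inr_ne_inl h
  · exact fun h => Sum.inl_ne_inr h

variable [Finite α] [Finite β]

theorem firstReturn_sumCongr (f : Perm α) (g : Perm β) :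
    ∀ x, sumSubtype p q
        (Perm.sumCongr (firstReturn f p) (firstReturn g q) x) =
      firstReturn (Perm.sumCongr f g) (Sum.elim p q) (sumSubtype p q x) := by
  have hpow : ∀ n : ℕ, Perm.sumCongr f g ^ n = Perm.sumCongr (f ^ n) (g ^ n) := fun n => by
    rw [← zpow_natCast, sumCongr_zpow, zpow_natCast, zpow_natCast]
  rintro (x | y)
  · obtain ⟨n, hn, hn'⟩ := firstReturn_spec f p x
    refine (firstReturn_eq n ?_ fun j hj => ?_).symm
    · rw [hpow]; exact congrArg Sum.inl hn
    · rw [hpow]; exact hn' j hj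
  · obtain ⟨n, hn, hn'⟩ := firstReturn_spec g q y
    refine (firstReturn_eq n ?_ fun j hj => ?_).symm
    · rw [hpow]; exact congrArg Sum.inr hn
    · rw [hpow]; exact hn' j hj

/-- Write `G` as `f ⊕ g` times a permutation supported on `p` and `q`, where it exchanges `s` and `γ
s`, and apply `numCycles_mul_add`. The same formula will count both edges and faces of a gluing. -/
theorem numCycles_glue (f : Perm α) (g : Perm β) (γ : {x // p x} ≃ {y // q y})
    (G : Perm (α ⊕ β)) (h₁ : ∀ x, ¬ p x → G (Sum.inl x) = Sum.inl (f x))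
    (h₂ : ∀ y, ¬ q y → G (Sum.inr y) = Sum.inr (g y))
    (h₃ : ∀ s : {x // p x}, G (Sum.inl s) = Sum.inr (g (γ s)))
    (h₄ : ∀ t : {y // q y}, G (Sum.inr t) = Sum.inl (f (γ.symm t))) :
    numCycles G + numCycles (firstReturn f p) + numCycles (firstReturn g q) =
      numCycles f + numCycles g +
        numCycles (Perm.sumCongr (firstReturn f p) (firstReturn g q) * exchange γ) := by
  set F := Perm.sumCongr f g with hF
  set P : α ⊕ β → Prop := Sum.elim p q with hP
  have e₁ : ∀ x, ¬ p x → (F⁻¹ * G) (Sum.inl x) = Sum.inl x := fun x hx => by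
    rw [mul_apply, h₁ x hx, inv_eq_iff_eq]; rfl
  have e₂ : ∀ y, ¬ q y → (F⁻¹ * G) (Sum.inr y) = Sum.inr y := fun y hy => by
    rw [mul_apply, h₂ y hy, inv_eq_iff_eq]; rfl
  have e₃ : ∀ s : {x // p x}, (F⁻¹ * G) (Sum.inl s) = Sum.inr (γ s : β) := fun s => by
    rw [mul_apply, h₃, inv_eq_iff_eq]; rfl
  have e₄ : ∀ t : {y // q y}, (F⁻¹ * G) (Sum.inr t) = Sum.inl (γ.symm t : α) := fun t => by
    rw [mul_apply, h₄, inv_eq_iff_eq]; rfl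
  have hfix : ∀ z, ¬ P z → (F⁻¹ * G) z = z := by
    rintro (x | y) hz
    · exact e₁ x hz
    · exact e₂ y hz
  have hpres : ∀ z, P ((F⁻¹ * G) z) ↔ P z := by
    rintro (x | y)
    · by_cases hx : p x
      · rw [e₃ ⟨x, hx⟩]; exact iff_of_true (γ ⟨x, hx⟩).2 hx
      · rw [e₁ x hx]
    · by_cases hy : q y
      · rw [e₄ ⟨y, hy⟩]; exact iff_of_true (γ.symm ⟨y, hy⟩).2 hy
      · rw [e₂ y hy]
  have key := numCycles_mul_add (f := F) hfix hpres
  rw [mul_inv_cancel_left] at key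
  have k1 := numCycles_congr (sumSubtype p q)
    (firstReturn_sumCongr (p := p) (q := q) f g)
  have k2 : numCycles (Perm.sumCongr (firstReturn f p) (firstReturn g q) * exchange γ) =
      numCycles (firstReturn F P * (F⁻¹ * G).subtypePerm hpres) := by
    refine numCycles_congr (sumSubtype p q) fun z => ?_
    rw [mul_apply, mul_apply, firstReturn_sumCongr]
    congr 1
    rcases z with s | t
    · exact Subtype.ext (e₃ s).symm
    · exact Subtype.ext (e₄ t).symm
  rw [numCycles_sumCongr (firstReturn f p) (firstReturn g q)] at k1
  change _ = numCycles (firstReturn F P) at k1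
  have k3 : numCycles F = numCycles f + numCycles g := numCycles_sumCongr f g
  omega

theorem numCycles_sumCongr_mul_exchange_le (γ : {x // p x} ≃ {y // q y}) (f : Perm {x // p x})
    (g : Perm {y // q y}) :
    numCycles (Perm.sumCongr f g * exchange γ) ≤ Nat.card {x // p x} := by
  have h1 := two_mul_numCycles_le _ (sumCongr_mul_exchange_ne γ f g)
  rw [Nat.card_sum, ← Nat.card_congr γ] at h1
  omega

/-- The permutation has no fixed point on its `2k` points, so `k` cycles means that it is an
involution. Two steps lead from `γ s` to `g (γ (f s))`, whence the reversal condition. -/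
theorem numCycles_sumCongr_mul_exchange_eq_iff (γ : {x // p x} ≃ {y // q y})
    (f : Perm {x // p x}) (g : Perm {y // q y}) :
    numCycles (Perm.sumCongr f g * exchange γ) = Nat.card {x // p x} ↔
      ∀ s, γ (f s) = g.symm (γ s) := by
  have h1 := two_mul_numCycles_eq_iff _ (sumCongr_mul_exchange_ne γ f g)
  rw [Nat.card_sum, ← Nat.card_congr γ] at h1
  have h2 : ∀ a b : ℕ, a = b ↔ 2 * a = b + b := by omega
  rw [h2, h1]
  have hl : ∀ s, (Perm.sumCongr f g * exchange γ) (Sum.inl s) = Sum.inr (g (γ s)) := fun _ => rfl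
  have hr : ∀ t, (Perm.sumCongr f g * exchange γ) (Sum.inr t) = Sum.inl (f (γ.symm t)) :=
    fun _ => rfl
  constructor
  · intro h s
    have h3 := h (Sum.inr (γ s))
    rw [hr, hl, γ.symm_apply_apply] at h3
    rw [Equiv.eq_symm_apply]
    exact Sum.inr_injective h3
  · rintro h (s | t)
    · rw [hl, hr]
      congr 1
      have h3 := h (γ.symm (g (γ s)))
      rw [γ.apply_symm_apply, symm_apply_apply] at h3
      exact γ.injective h3
    · rw [hr, hl, h, γ.apply_symm_apply, apply_symm_apply]

end GluePerm

/-! ### Maps with stems -/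

/-- A map with stems: the fixed points of `inv` are the stems, its cycles of length two are the
edges. -/
structure StemMap : Type 1 where
  Dart : Type
  finite : Finite Dart
  rot : Equiv.Perm Dart
  inv : Equiv.Perm Dart
  inv_inv : ∀ x, inv (inv x) = x

attribute [instance] StemMap.finite

namespace StemMap

variable (X Y : StemMap)

/-- Half-edges that do not belong to an edge. -/
abbrev Stem : Type := {x : X.Dart // X.inv x = x}

/-- Connectedness (and non-emptiness) of a map with stems. -/
def Connected : Prop :=
  Nonempty X.Dart ∧ ∀ U : Set X.Dart, (∀ x ∈ U, X.rot x ∈ U) → (∀ x ∈ U, X.inv x ∈ U) →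
    ∀ x ∈ U, ∀ y, y ∈ U

/-- Euler's relation; a stem is not counted as a vertex of degree one. -/
def Planar : Prop :=
  numCycles X.rot + numCycles X.inv + numCycles (X.rot * X.inv) = Nat.card X.Dart + 2

/-- The permutation sending each stem to the next one along the boundary of its face. -/
noncomputable def nextStem : Equiv.Perm X.Stem :=
  firstReturn (X.rot * X.inv) fun x => X.inv x = x

variable {X Y}

open Equiv Equiv.Perm in
theorem firstReturn_inv (X : StemMap) : firstReturn X.inv (fun x => X.inv x = x) = 1 := by
  ext1 x
  exact firstReturn_eq 0 (by simpa using x.2.symm) (by simp)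

theorem Connected.euler_le (h : X.Connected) :
    numCycles X.rot + numCycles X.inv + numCycles (X.rot * X.inv) ≤ Nat.card X.Dart + 2 := by
  refine (numCycles_add_le X.rot X.inv X.inv_inv).trans (Nat.add_le_add_left ?_ _)
  have : Nat.card (Quotient (orbitSetoid X.rot X.inv)) ≤ 1 := by
    rw [Finite.card_le_one_iff_subsingleton]
    refine ⟨?_⟩
    rintro ⟨x⟩ ⟨y⟩
    refine Quotient.sound (h.2 {y | orbitSetoid X.rot X.inv x y} (fun y hy => ?_)
      (fun y hy => ?_) x ((orbitSetoid X.rot X.inv).refl x) y)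
    · exact (orbitSetoid X.rot X.inv).trans hy
        ((le_sup_left : _ ≤ orbitSetoid X.rot X.inv)
          (show Equiv.Perm.SameCycle X.rot y (X.rot y) from ⟨1, rfl⟩))
    · exact (orbitSetoid X.rot X.inv).trans hy
        ((le_sup_right : _ ≤ orbitSetoid X.rot X.inv)
          (show Equiv.Perm.SameCycle X.inv y (X.inv y) from ⟨1, rfl⟩))
  omega

end StemMap

/-! ### Planarity in terms of cycle counts -/

namespace RibbonGraph

variable (M : RibbonGraph)

theorem opp_ne (d : M.Dart) : M.opp d ≠ d := fun h => M.colour_opp d (by rw [h])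

theorem two_mul_numCycles_opp : 2 * numCycles M.opp = Nat.card M.Dart :=
  (two_mul_numCycles_eq_iff M.opp M.opp_ne).2 M.opp_opp

theorem connected_iff :
    (∀ x y : M.Dart, ∃ g ∈ Subgroup.closure {M.rot, M.opp}, g x = y) ↔
      ∀ U : Set M.Dart, (∀ x ∈ U, M.rot x ∈ U) → (∀ x ∈ U, M.opp x ∈ U) →
        ∀ x ∈ U, ∀ y, y ∈ U := by
  constructor
  · intro h U h1 h2 x hx y
    obtain ⟨g, hg, rfl⟩ := h x y
    have key : ∀ x, g x ∈ U ↔ x ∈ U := by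
      induction hg using Subgroup.closure_induction with
      | mem g hg =>
        rcases hg with rfl | rfl
        · exact Equiv.Perm.mem_iff_of_closed h1
        · exact Equiv.Perm.mem_iff_of_closed h2
      | one => exact fun _ => Iff.rfl
      | mul a b _ _ ha hb => exact fun x => (ha _).trans (hb x)
      | inv a _ ha =>
        intro x
        rw [← ha (a⁻¹ x), ← Equiv.Perm.mul_apply, mul_inv_cancel, Equiv.Perm.one_apply]
    exact (key x).2 hx
  · intro h x
    refine h {y | ∃ g ∈ Subgroup.closure {M.rot, M.opp}, g x = y} ?_ ?_ x
      ⟨1, Subgroup.one_mem _, rfl⟩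
    · rintro _ ⟨g, hg, rfl⟩
      exact ⟨M.rot * g, Subgroup.mul_mem _ (Subgroup.subset_closure (Or.inl rfl)) hg, rfl⟩
    · rintro _ ⟨g, hg, rfl⟩
      exact ⟨M.opp * g, Subgroup.mul_mem _ (Subgroup.subset_closure (Or.inr rfl)) hg, rfl⟩

/-- As half-edges are twice the edges, Euler's relation can be written symmetrically in the three
permutations. In this form it still makes sense with stems. -/
theorem isPlanarMap_iff : M.IsPlanarMap ↔
    (∀ U : Set M.Dart, (∀ x ∈ U, M.rot x ∈ U) → (∀ x ∈ U, M.opp x ∈ U) →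
        ∀ x ∈ U, ∀ y, y ∈ U) ∧
      numCycles M.rot + numCycles M.opp + numCycles (M.rot * M.opp) = Nat.card M.Dart + 2 := by
  unfold IsPlanarMap
  rw [connected_iff]
  refine and_congr_right fun _ => ?_
  have := M.two_mul_numCycles_opp
  change numCycles M.rot + numCycles (M.rot * M.opp) = numCycles M.opp + 2 ↔ _
  omega

end RibbonGraph

/-- `M` is obtained from two maps with stems by merging matched stems into edges. -/
structure Gluing (M : RibbonGraph) (X Y : StemMap) where
  e : X.Dart ⊕ Y.Dart ≃ M.Dart
  γ : X.Stem ≃ Y.Stem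
  rot_inl : ∀ x, M.rot (e (Sum.inl x)) = e (Sum.inl (X.rot x))
  rot_inr : ∀ y, M.rot (e (Sum.inr y)) = e (Sum.inr (Y.rot y))
  opp_inl : ∀ x, X.inv x ≠ x → M.opp (e (Sum.inl x)) = e (Sum.inl (X.inv x))
  opp_inr : ∀ y, Y.inv y ≠ y → M.opp (e (Sum.inr y)) = e (Sum.inr (Y.inv y))
  opp_stem : ∀ s : X.Stem, M.opp (e (Sum.inl s)) = e (Sum.inr (γ s))

/-! ### Euler's relation for a gluing -/

namespace Gluing

open Equiv Equiv.Perm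

variable {M : RibbonGraph} {X Y : StemMap}

theorem opp_stem_symm (g : Gluing M X Y) (t : Y.Stem) :
    M.opp (g.e (Sum.inr t)) = g.e (Sum.inl (g.γ.symm t)) := by
  have h := g.opp_stem (g.γ.symm t)
  rw [g.γ.apply_symm_apply] at h
  rw [← h, M.opp_opp]

theorem card_dart (g : Gluing M X Y) : Nat.card M.Dart = Nat.card X.Dart + Nat.card Y.Dart := by
  rw [← Nat.card_sum]
  exact (Nat.card_congr g.e).symm

theorem numCycles_rot (g : Gluing M X Y) : numCycles M.rot = numCycles X.rot + numCycles Y.rot := by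
  rw [← numCycles_sumCongr]
  symm
  refine numCycles_congr g.e ?_
  rintro (x | y)
  · exact (g.rot_inl x).symm
  · exact (g.rot_inr y).symm

/-- Each matched pair of stems turns two fixed points into a single edge. In `numCycles_glue` both
first return permutations are trivial here. -/
theorem numCycles_opp_add (g : Gluing M X Y) :
    numCycles M.opp + Nat.card X.Stem = numCycles X.inv + numCycles Y.inv := by
  have key := numCycles_glue X.inv Y.inv g.γ (g.e.symm.permCongr M.opp)
    (fun x hx => by simp [permCongr_apply, g.opp_inl x hx])
    (fun y hy => by simp [permCongr_apply, g.opp_inr y hy])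
    (fun s => by simp [permCongr_apply, g.opp_stem s, (g.γ s).2])
    (fun t => by simp [permCongr_apply, g.opp_stem_symm t, (g.γ.symm t).2])
  have h1 : numCycles (g.e.symm.permCongr M.opp) = numCycles M.opp :=
    numCycles_congr g.e fun x => by simp [permCongr_apply]
  have h2 := (numCycles_sumCongr_mul_exchange_eq_iff g.γ 1 1).2 fun _ => rfl
  rw [X.firstReturn_inv, Y.firstReturn_inv, numCycles_one, numCycles_one, h1, h2,
    ← Nat.card_congr g.γ] at key
  omega

theorem numCycles_face_add (g : Gluing M X Y) :
    numCycles (M.rot * M.opp) + numCycles X.nextStem + numCycles Y.nextStem =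
      numCycles (X.rot * X.inv) + numCycles (Y.rot * Y.inv) +
        numCycles (Perm.sumCongr X.nextStem Y.nextStem * exchange g.γ) := by
  have key := numCycles_glue (X.rot * X.inv) (Y.rot * Y.inv) g.γ
    (g.e.symm.permCongr (M.rot * M.opp))
    (fun x hx => by simp [permCongr_apply, g.opp_inl x hx, g.rot_inl])
    (fun y hy => by simp [permCongr_apply, g.opp_inr y hy, g.rot_inr])
    (fun s => by simp [permCongr_apply, g.opp_stem s, (g.γ s).2, g.rot_inr])
    (fun t => by simp [permCongr_apply, g.opp_stem_symm t, (g.γ.symm t).2, g.rot_inl])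
  have h1 : numCycles (g.e.symm.permCongr (M.rot * M.opp)) = numCycles (M.rot * M.opp) :=
    numCycles_congr g.e fun x => by simp [permCongr_apply]
  rw [h1] at key
  exact key

theorem connected (g : Gluing M X Y) (hX : X.Connected) (hY : Y.Connected) (s : X.Stem) :
    ∀ U : Set M.Dart, (∀ x ∈ U, M.rot x ∈ U) → (∀ x ∈ U, M.opp x ∈ U) →
      ∀ x ∈ U, ∀ y, y ∈ U := by
  intro U h1 h2
  have hx : ∀ x, g.e (Sum.inl x) ∈ U → ∀ x', g.e (Sum.inl x') ∈ U := by
    refine hX.2 {x | g.e (Sum.inl x) ∈ U} (fun x hx => ?_) (fun x hx => ?_)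
    · change g.e _ ∈ U; rw [← g.rot_inl]; exact h1 _ hx
    · by_cases h : X.inv x = x
      · rwa [h]
      · change g.e _ ∈ U; rw [← g.opp_inl x h]; exact h2 _ hx
  have hy : ∀ y, g.e (Sum.inr y) ∈ U → ∀ y', g.e (Sum.inr y') ∈ U := by
    refine hY.2 {y | g.e (Sum.inr y) ∈ U} (fun y hy => ?_) (fun y hy => ?_)
    · change g.e _ ∈ U; rw [← g.rot_inr]; exact h1 _ hy
    · by_cases h : Y.inv y = y
      · rwa [h]
      · change g.e _ ∈ U; rw [← g.opp_inr y h]; exact h2 _ hy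
  have hxy : ∀ x, g.e (Sum.inl x) ∈ U → ∀ y, g.e (Sum.inr y) ∈ U := fun x h y =>
    hy (g.γ s) (by rw [← g.opp_stem]; exact h2 _ (hx x h _)) y
  have hyx : ∀ y, g.e (Sum.inr y) ∈ U → ∀ x, g.e (Sum.inl x) ∈ U := fun y h x =>
    hx s (by
      rw [← M.opp_opp (g.e (Sum.inl s.1)), g.opp_stem]
      exact h2 _ (hy y h _)) x
  intro d hd d'
  obtain ⟨z, rfl⟩ := g.e.surjective d
  obtain ⟨z', rfl⟩ := g.e.surjective d'
  rcases z with x | y <;> rcases z' with x' | y'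
  exacts [hx x hd x', hxy x hd y', hyx y hd x', hy y hd y']

/-- A gluing of two connected maps with stems is planar when both are planar, the stems of each of
them lie along a single face, and the matching reverses their cyclic orders. -/
theorem isPlanarMap_iff (g : Gluing M X Y) (hX : X.Connected) (hY : Y.Connected)
    (hs : Nonempty X.Stem) :
    M.IsPlanarMap ↔ X.Planar ∧ Y.Planar ∧ numCycles X.nextStem = 1 ∧ numCycles Y.nextStem = 1 ∧
      ∀ s, g.γ (X.nextStem s) = Y.nextStem.symm (g.γ s) := by
  have hs' : Nonempty Y.Stem := hs.map g.γ
  rw [M.isPlanarMap_iff, and_iff_right (g.connected hX hY hs.some),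
    ← numCycles_sumCongr_mul_exchange_eq_iff]
  have h1 := g.numCycles_rot
  have h2 := g.numCycles_opp_add
  have h3 := g.numCycles_face_add
  have h4 := g.card_dart
  have h5 := numCycles_sumCongr_mul_exchange_le g.γ X.nextStem Y.nextStem
  have h6 := hX.euler_le
  have h7 := hY.euler_le
  have h8 := numCycles_pos X.nextStem
  have h9 := numCycles_pos Y.nextStem
  change _ ↔ _ ∧ _ ∧ _ ∧ _ ∧ _ = Nat.card X.Stem
  change _ ≤ Nat.card X.Stem at h5
  unfold StemMap.Planar
  -- The Euler defect of `M` is the sum of those of `X` and `Y`, the excesses over one of the cycle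
  -- counts of the two `nextStem`, and the gap in `h5`. All are nonnegative, so the sum vanishes iff
  -- each term does.
  omega

end Gluing

/-! ### Semiconjugacies of transitive permutations -/

section Semiconj

open Equiv Equiv.Perm

variable {α β : Type*}

theorem apply_ne_of_forall_sameCycle [Nontrivial α] {f : Perm α} (h : ∀ x y, SameCycle f x y)
    (x : α) : f x ≠ x := fun hx => by
  obtain ⟨y, hy⟩ := exists_ne x
  exact hy ((h x y).eq_of_left hx).symm

variable [Finite α]

theorem exists_perm_semiconj {f g : Perm α} (hf : ∀ x y, SameCycle f x y)
    (hg : ∀ x y, SameCycle g x y) : ∃ e : Perm α, ∀ x, e (f x) = g (e x) := by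
  classical
  have := Fintype.ofFinite α
  -- On a single point a transitive permutation is the identity, which is not `IsCycle`; beyond
  -- that, two full cycles are conjugate.
  rcases subsingleton_or_nontrivial α with h | h
  · exact ⟨1, fun x => Subsingleton.elim _ _⟩
  have hc : ∀ {k : Perm α}, (∀ x y, SameCycle k x y) → k.IsCycle ∧ k.support = Finset.univ := by
    intro k hk
    obtain ⟨x⟩ := h.to_nonempty
    refine ⟨⟨x, apply_ne_of_forall_sameCycle hk x, fun y _ => hk x y⟩, ?_⟩
    ext y
    simp [apply_ne_of_forall_sameCycle hk y]
  obtain ⟨e, he⟩ := isConj_iff.1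
    ((hc hf).1.isConj (hc hg).1 (by rw [(hc hf).2, (hc hg).2]))
  refine ⟨e, fun x => ?_⟩
  rw [← he]
  simp

theorem semiconj_eq_of_apply_eq {f : Perm α} {g : Perm β} (hf : ∀ x y, SameCycle f x y)
    {e e' : α ≃ β} (he : ∀ x, e (f x) = g (e x)) (he' : ∀ x, e' (f x) = g (e' x)) {a : α}
    (ha : e a = e' a) : e = e' :=
  Equiv.ext fun x => SameCycle.mem_of_closed (U := {x | e x = e' x})
    (fun y hy => by
      change e (f y) = e' (f y)
      rw [he, he', show e y = e' y from hy]) (hf a x) ha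

variable [Finite β]

theorem exists_equiv_semiconj {f : Perm α} {g : Perm β} (hf : ∀ x y, SameCycle f x y)
    (hg : ∀ x y, SameCycle g x y) (hc : Nat.card α = Nat.card β) :
    ∃ e : α ≃ β, ∀ x, e (f x) = g (e x) := by
  obtain ⟨e₀⟩ : Nonempty (α ≃ β) :=
    ⟨(Finite.equivFin α).trans ((finCongr hc).trans (Finite.equivFin β).symm)⟩
  have hf' : ∀ x y, SameCycle (e₀.permCongr f) x y := by
    intro x y
    have := SameCycle.map (f := f) (g := e₀.permCongr f) e₀
      (fun x => ⟨1, by simp [permCongr_apply]⟩) (hf (e₀.symm x) (e₀.symm y))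
    simpa using this
  obtain ⟨e, he⟩ := exists_perm_semiconj hf' hg
  refine ⟨e₀.trans e, fun x => ?_⟩
  have := he (e₀ x)
  simpa [permCongr_apply] using this

/-- A semiconjugacy is determined by its value at one point, and composing a given one with powers
of `g` realises every value. -/
theorem card_semiconj [Nonempty α] {f : Perm α} {g : Perm β} (hf : ∀ x y, SameCycle f x y)
    (hg : ∀ x y, SameCycle g x y) (hc : Nat.card α = Nat.card β) :
    Nat.card {e : α ≃ β // ∀ x, e (f x) = g (e x)} = Nat.card α := by
  obtain ⟨e₀, he₀⟩ := exists_equiv_semiconj hf hg hc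
  obtain ⟨a⟩ := ‹Nonempty α›
  rw [hc]
  refine Nat.card_congr (Equiv.ofBijective (fun e => e.1 a) ⟨fun e e' h => ?_, fun y => ?_⟩)
  · exact Subtype.ext (semiconj_eq_of_apply_eq hf e.2 e'.2 h)
  · obtain ⟨i, hi⟩ := hg (e₀ a) y
    refine ⟨⟨e₀.trans (g ^ i), fun x => ?_⟩, hi⟩
    change (g ^ i) (e₀ (f x)) = g ((g ^ i) (e₀ x))
    rw [he₀, ← mul_apply, ← mul_apply, (Commute.refl g).zpow_left i]

end Semiconj

/-! ### Restrictions and stars -/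

namespace StemMap

open Equiv Equiv.Perm

/-- A single vertex carrying only stems, in the cyclic order given by `s`. -/
def star (T : Type) [Finite T] (s : Perm T) : StemMap := ⟨T, inferInstance, s, 1, fun _ => rfl⟩

variable {T : Type} [Finite T] {s : Perm T}

theorem star_nextStem (x : (star T s).Stem) : ((star T s).nextStem x).1 = s x.1 := by
  have := firstReturn_eq (f := (star T s).rot * (star T s).inv)
    (p := fun x => (star T s).inv x = x) (x := x) (y := ⟨s x.1, rfl⟩) 0
    rfl (by simp)
  exact congrArg Subtype.val this

theorem star_connected [Nonempty T] (hs : ∀ x y, SameCycle s x y) : (star T s).Connected :=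
  ⟨‹_›, fun _ h _ x hx y => SameCycle.mem_of_closed h (hs x y) hx⟩

theorem star_planar [Nonempty T] (hs : ∀ x y, SameCycle s x y) : (star T s).Planar := by
  change numCycles s + numCycles (1 : Perm T) + numCycles s = Nat.card T + 2
  rw [numCycles_one, (numCycles_eq_one_iff s).2 hs]
  omega

theorem star_numCycles_nextStem [Nonempty T] (hs : ∀ x y, SameCycle s x y) :
    numCycles (star T s).nextStem = 1 := by
  rw [← (numCycles_eq_one_iff s).2 hs]
  exact numCycles_congr (Equiv.subtypeUnivEquiv (α := T) fun _ => rfl) star_nextStem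

end StemMap

/-- The star is planar, all its stems lie along one face, and its `nextStem` is `s`; only the
conditions on `X` and on the order remain. -/
theorem Gluing.isPlanarMap_star_iff {M : RibbonGraph} {X : StemMap} {T : Type} [Finite T]
    [Nonempty T] {s : Equiv.Perm T} (g : Gluing M X (StemMap.star T s)) (hX : X.Connected)
    (hs : ∀ x y, s.SameCycle x y) :
    M.IsPlanarMap ↔ X.Planar ∧ numCycles X.nextStem = 1 ∧
      ∀ x, (g.γ (X.nextStem x)).1 = s.symm (g.γ x).1 := by
  have hne : Nonempty X.Stem := ‹Nonempty T›.map fun t => g.γ.symm ⟨t, rfl⟩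
  have hrel : ∀ x, g.γ (X.nextStem x) = (StemMap.star T s).nextStem.symm (g.γ x) ↔
      (g.γ (X.nextStem x)).1 = s.symm (g.γ x).1 := by
    intro x
    rw [Equiv.eq_symm_apply, Subtype.ext_iff, StemMap.star_nextStem]
    exact (Equiv.eq_symm_apply s).symm
  rw [g.isPlanarMap_iff hX (StemMap.star_connected hs) hne, forall_congr' hrel,
    and_iff_right (StemMap.star_planar hs), and_iff_right (StemMap.star_numCycles_nextStem hs)]

namespace RibbonGraph

variable (M : RibbonGraph) (A : Set M.Vertex)

open Classical in
/-- The vertices of `A` with their half-edges and the edges between them; the other edges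
incident to `A` become stems. -/
noncomputable def restrict : StemMap where
  Dart := {d : M.Dart // M.vert d ∈ A}
  finite := inferInstance
  rot := M.rot.subtypePerm fun d => by rw [M.vert_rot]
  inv := Function.Involutive.toPerm
    (fun x => if h : M.vert (M.opp x.1) ∈ A then ⟨M.opp x.1, h⟩ else x) fun x => by
      by_cases h : M.vert (M.opp x.1) ∈ A
      · simp [h, M.opp_opp, x.2]
      · simp [h]
  inv_inv x := Function.Involutive.toPerm_involutive _ x

variable {M A}

theorem restrict_inv_of_mem (x : (M.restrict A).Dart) (h : M.vert (M.opp x.1) ∈ A) :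
    (M.restrict A).inv x = ⟨M.opp x.1, h⟩ :=
  dif_pos h

theorem restrict_inv_of_notMem (x : (M.restrict A).Dart) (h : M.vert (M.opp x.1) ∉ A) :
    (M.restrict A).inv x = x :=
  dif_neg h

theorem restrict_inv_eq_iff (x : (M.restrict A).Dart) :
    (M.restrict A).inv x = x ↔ M.vert (M.opp x.1) ∉ A := by
  refine ⟨fun h hA => ?_, restrict_inv_of_notMem x⟩
  rw [restrict_inv_of_mem x hA] at h
  exact M.opp_ne x.1 (congrArg Subtype.val h)

variable (M A)

open Classical in
/-- A map is obtained by gluing its restrictions to complementary sets of vertices. -/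
noncomputable def restrictGluing : Gluing M (M.restrict A) (M.restrict Aᶜ) where
  e := Equiv.sumCompl fun d => M.vert d ∈ A
  γ :=
    { toFun x := ⟨⟨M.opp x.1.1, (restrict_inv_eq_iff _).1 x.2⟩,
        (restrict_inv_eq_iff _).2 fun h => h (by rw [M.opp_opp]; exact x.1.2)⟩
      invFun y := ⟨⟨M.opp y.1.1, not_not.1 ((restrict_inv_eq_iff _).1 y.2)⟩,
        (restrict_inv_eq_iff _).2 (by rw [M.opp_opp]; exact y.1.2)⟩
      left_inv x := Subtype.ext (Subtype.ext (M.opp_opp _))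
      right_inv y := Subtype.ext (Subtype.ext (M.opp_opp _)) }
  rot_inl _ := rfl
  rot_inr _ := rfl
  opp_inl x h := by
    have h' := not_not.1 (mt (restrict_inv_eq_iff x).2 h)
    rw [restrict_inv_of_mem x h']
    rfl
  opp_inr y h := by
    have h' := not_not.1 (mt (restrict_inv_eq_iff y).2 h)
    rw [restrict_inv_of_mem y h']
    rfl
  opp_stem _ := rfl

end RibbonGraph

/-! ### The marked vertex of a pointed map -/

namespace PointedMap

open Equiv Equiv.Perm

variable (P : PointedMap)

/-- Half-edges incident to the marked vertex. -/
abbrev TauDart : Type := {d : P.M.Dart // P.M.vert d = P.τ}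

instance : Nonempty P.TauDart := by
  obtain ⟨d, hd⟩ := Quotient.exists_rep P.τ
  exact ⟨⟨d, hd⟩⟩

/-- The cyclic order of the half-edges around the marked vertex. -/
def tauRot : Perm P.TauDart := P.M.rot.subtypePerm fun d => by rw [P.M.vert_rot]

theorem tauRot_sameCycle (x y : P.TauDart) : SameCycle P.tauRot x y :=
  sameCycle_subtypePerm.2 ((P.M.vert_eq_iff _ _).1 (x.2.trans y.2.symm))

theorem degree_eq : P.M.degree P.τ = Nat.card P.TauDart := rfl

/-- The map with stems left when the marked vertex is deleted. -/
noncomputable def rest : StemMap := P.M.restrict {P.τ}ᶜ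

variable {P}

theorem rest_inv_of_ne (x : P.rest.Dart) (h : P.M.vert (P.M.opp x.1) ≠ P.τ) :
    P.rest.inv x = ⟨P.M.opp x.1, h⟩ :=
  RibbonGraph.restrict_inv_of_mem x h

theorem rest_inv_eq_iff (x : P.rest.Dart) :
    P.rest.inv x = x ↔ P.M.vert (P.M.opp x.1) = P.τ :=
  (RibbonGraph.restrict_inv_eq_iff x).trans not_not

variable (P)

/-- Stems correspond to half-edges incident to the marked vertex. -/
noncomputable def stemEquiv : P.rest.Stem ≃ P.TauDart where
  toFun x := ⟨P.M.opp x.1.1, (rest_inv_eq_iff x.1).1 x.2⟩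
  invFun d := ⟨⟨P.M.opp d.1, P.opp_vert_ne d.1 d.2⟩,
    (rest_inv_eq_iff _).2 (by rw [P.M.opp_opp]; exact d.2)⟩
  left_inv x := Subtype.ext (Subtype.ext (P.M.opp_opp _))
  right_inv d := Subtype.ext (P.M.opp_opp _)

open Classical in
/-- A pointed map is obtained by gluing the star of its marked vertex to the rest. -/
noncomputable def restGluing : Gluing P.M P.rest (StemMap.star P.TauDart P.tauRot) where
  e := (Equiv.sumComm _ _).trans (Equiv.sumCompl fun d => P.M.vert d = P.τ)
  γ := P.stemEquiv.trans (Equiv.subtypeUnivEquiv fun _ => rfl).symm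
  rot_inl _ := rfl
  rot_inr _ := rfl
  opp_inl x h := by
    rw [rest_inv_of_ne x (mt (rest_inv_eq_iff x).2 h)]
    rfl
  opp_inr y h := (h rfl).elim
  opp_stem _ := rfl

variable {P}

/-- Reads the planarity of `P` through its decomposition into the rest and a star: the stems lie
along one face, in the order opposite to that of the half-edges around `τ`. -/
theorem rest_planar_and (h : P.rest.Connected) :
    P.rest.Planar ∧ numCycles P.rest.nextStem = 1 ∧
      ∀ x, P.stemEquiv (P.rest.nextStem x) = P.tauRot.symm (P.stemEquiv x) :=
  (P.restGluing.isPlanarMap_star_iff h P.tauRot_sameCycle).1 P.planar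

end PointedMap

/-! ### Planar regluings of two pointed maps -/

open Equiv in
/-- The glued map as a gluing of maps with stems. -/
noncomputable def glueGluing (P Q : PointedMap) (hc : P.M.vertColour P.τ ≠ Q.M.vertColour Q.τ)
    (β : Matching P Q) : Gluing (glue P Q hc β) P.rest Q.rest where
  e := Equiv.refl _
  γ := (P.stemEquiv.trans β).trans Q.stemEquiv.symm
  rot_inl _ := rfl
  rot_inr _ := rfl
  opp_inl x h := by
    have h' := mt (PointedMap.rest_inv_eq_iff x).2 h
    rw [PointedMap.rest_inv_of_ne x h']
    exact glueHalf_inner P Q β x h'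
  opp_inr y h := by
    have h' := mt (PointedMap.rest_inv_eq_iff y).2 h
    rw [PointedMap.rest_inv_of_ne y h']
    exact congrArg Sum.swap (glueHalf_inner Q P β.symm y h')
  opp_stem s := glueHalf_stem P Q β s.1 ((PointedMap.rest_inv_eq_iff s.1).1 s.2)

/-- By `rest_planar_and` both rests meet all requirements of the gluing criterion except the one on
the matching. On each side `stemEquiv` turns `nextStem` into the inverse of `tauRot`. -/
theorem glue_isPlanarMap_iff (P Q : PointedMap)
    (hc : P.M.vertColour P.τ ≠ Q.M.vertColour Q.τ) (hP : P.rest.Connected)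
    (hQ : Q.rest.Connected) (β : Matching P Q) :
    (glue P Q hc β).IsPlanarMap ↔ ∀ d, β (P.tauRot.symm d) = Q.tauRot (β d) := by
  obtain ⟨p1, p2, p3⟩ := PointedMap.rest_planar_and hP
  obtain ⟨q1, q2, q3⟩ := PointedMap.rest_planar_and hQ
  rw [(glueGluing P Q hc β).isPlanarMap_iff hP hQ
    ((inferInstance : Nonempty P.TauDart).map P.stemEquiv.symm), and_iff_right p1, and_iff_right q1,
    and_iff_right p2, and_iff_right q2]
  have q3' : ∀ y, Q.stemEquiv (Q.rest.nextStem.symm y) = Q.tauRot (Q.stemEquiv y) := by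
    intro y
    rw [← Equiv.symm_apply_eq, ← q3, Equiv.apply_symm_apply]
  rw [← P.stemEquiv.forall_congr_right]
  refine forall_congr' fun x => ?_
  change Q.stemEquiv.symm (β (P.stemEquiv (P.rest.nextStem x))) =
    Q.rest.nextStem.symm (Q.stemEquiv.symm (β (P.stemEquiv x))) ↔ _
  rw [Equiv.symm_apply_eq, q3', Equiv.apply_symm_apply, p3]

theorem card_planar_matching (P Q : PointedMap)
    (hc : P.M.vertColour P.τ ≠ Q.M.vertColour Q.τ) (hP : P.rest.Connected)
    (hQ : Q.rest.Connected) (hd : P.M.degree P.τ = Q.M.degree Q.τ) :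
    Nat.card {β : Matching P Q // (glue P Q hc β).IsPlanarMap} = P.M.degree P.τ := by
  rw [P.degree_eq, ← card_semiconj (f := P.tauRot.symm) (g := Q.tauRot)
    (fun x y => Equiv.Perm.sameCycle_inv.2 (P.tauRot_sameCycle x y)) Q.tauRot_sameCycle hd]
  exact Nat.card_congr (Equiv.subtypeEquivRight fun β => glue_isPlanarMap_iff P Q hc hP hQ β)

/-! ### Cuts -/

/-- The other colour. -/
def Colour.flip : Colour → Colour
  | black => white
  | white => black

theorem Colour.eq_flip_iff {a b c : Colour} (h : a ≠ b) : b = c.flip ↔ a = c := by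
  cases a <;> cases b <;> cases c <;> simp_all [Colour.flip]

namespace RibbonGraph

variable {M : RibbonGraph} {c : Colour} {ρ τ : M.Vertex} {S S' : Set M.Vertex}

instance : Finite M.Vertex := inferInstanceAs (Finite (Quotient _))

theorem exists_vert_eq (v : M.Vertex) : ∃ d, M.vert d = v := Quotient.exists_rep v

theorem mem_cutSet_compl {d : M.Dart} : d ∈ M.cutSet Sᶜ ↔ M.opp d ∈ M.cutSet S := by
  simp only [cutSet, Set.mem_ofPred_eq, Set.mem_compl_iff, M.opp_opp, not_not]
  exact and_comm

theorem cutWeight_compl (S : Set M.Vertex) : M.cutWeight Sᶜ = M.cutWeight S := by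
  have h : M.cutSet Sᶜ = M.opp ⁻¹' M.cutSet S := Set.ext fun _ => mem_cutSet_compl
  rw [cutWeight, cutWeight, h]
  exact Set.ncard_preimage_of_injective_subset_range M.opp.injective
    (by rw [M.opp.surjective.range_eq]; exact Set.subset_univ _)

/-- The two ends of a cut edge have opposite colours, so a cut seen from its other side has the
other colour. This transfers results from the side of `τ` to the side of `ρ`. -/
theorem isCut_compl : M.IsCut c.flip τ ρ Sᶜ ↔ M.IsCut c ρ τ S := by
  unfold IsCut
  rw [compl_compl, and_left_comm, ← M.opp.forall_congr_right]
  refine and_congr_right fun _ => and_congr_right fun _ => forall_congr' fun d => ?_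
  rw [mem_cutSet_compl, M.opp_opp]
  exact imp_congr_right fun _ => Colour.eq_flip_iff (M.colour_opp d).symm

theorem isMinimalCut_compl : M.IsMinimalCut c.flip τ ρ Sᶜ ↔ M.IsMinimalCut c ρ τ S := by
  unfold IsMinimalCut
  rw [isCut_compl, cutWeight_compl]
  refine and_congr_right fun _ => ⟨fun h S' hS' => ?_, fun h S' hS' => ?_⟩
  · rw [← cutWeight_compl S']
    exact h _ (isCut_compl.2 hS')
  · rw [← cutWeight_compl S']
    exact h _ (isCut_compl.1 (by rwa [compl_compl]))

/-- An edge leaving `S ∩ S'` leaves `S` or `S'`, and its inner end belongs to both, so its colour is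
prescribed. -/
theorem IsCut.inter (h : M.IsCut c ρ τ S) (h' : M.IsCut c ρ τ S') :
    M.IsCut c ρ τ (S ∩ S') := by
  refine ⟨fun hρ => h.1 hρ.1, ⟨h.2.1, h'.2.1⟩, fun d hd => ?_⟩
  by_cases h1 : M.vert (M.opp d) ∈ S
  · exact h'.2.2 d ⟨hd.1.2, fun h2 => hd.2 ⟨h1, h2⟩⟩
  · exact h.2.2 d ⟨hd.1.1, h1⟩

theorem IsCut.union (h : M.IsCut c ρ τ S) (h' : M.IsCut c ρ τ S') :
    M.IsCut c ρ τ (S ∪ S') := by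
  refine ⟨fun hρ => hρ.elim h.1 h'.1, Or.inl h.2.1, fun d hd => ?_⟩
  rcases hd.1 with h1 | h1
  · exact h.2.2 d ⟨h1, fun h2 => hd.2 (Or.inl h2)⟩
  · exact h'.2.2 d ⟨h1, fun h2 => hd.2 (Or.inr h2)⟩

/-- Submodularity, edge by edge: an edge cut by the intersection or the union is cut by `S` or `S'`,
and an edge cut by both of the former is cut by both of the latter. -/
theorem cutWeight_inter_add_union_le (S S' : Set M.Vertex) :
    M.cutWeight (S ∩ S') + M.cutWeight (S ∪ S') ≤ M.cutWeight S + M.cutWeight S' := by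
  unfold cutWeight
  rw [← Set.ncard_union_add_ncard_inter, ← Set.ncard_union_add_ncard_inter (M.cutSet S)]
  refine Nat.add_le_add (Set.ncard_le_ncard ?_ (Set.toFinite _))
    (Set.ncard_le_ncard ?_ (Set.toFinite _))
  · intro d
    simp only [cutSet, Set.mem_union, Set.mem_inter_iff, Set.mem_ofPred_eq]
    tauto
  · intro d
    simp only [cutSet, Set.mem_union, Set.mem_inter_iff, Set.mem_ofPred_eq]
    tauto

theorem IsMinimalCut.inter (h : M.IsMinimalCut c ρ τ S) (h' : M.IsMinimalCut c ρ τ S') :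
    M.IsMinimalCut c ρ τ (S ∩ S') := by
  refine ⟨h.1.inter h'.1, fun T hT => ?_⟩
  have h1 := cutWeight_inter_add_union_le S S'
  have h2 := h.2 _ (h.1.union h'.1)
  have h3 := h'.2 T hT
  omega

theorem IsMinimalCut.cutWeight_eq (h : M.IsMinimalCut c ρ τ S) (h' : M.IsMinimalCut c ρ τ S') :
    M.cutWeight S = M.cutWeight S' :=
  le_antisymm (h.2 _ h'.1) (h'.2 _ h.1)

/-- The side of `τ` of a minimal cut is connected. -/
theorem IsMinimalCut.restrict_connected (hM : M.IsPlanarMap) (h : M.IsMinimalCut c ρ τ S) :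
    (M.restrict S).Connected := by
  obtain ⟨t, ht⟩ := exists_vert_eq τ
  obtain ⟨r, hr⟩ := exists_vert_eq ρ
  have htS : M.vert t ∈ S := ht ▸ h.1.2.1
  have key : ∀ U : Set (M.restrict S).Dart, (∀ x ∈ U, (M.restrict S).rot x ∈ U) →
      (∀ x ∈ U, (M.restrict S).inv x ∈ U) → (⟨t, htS⟩ : (M.restrict S).Dart) ∈ U →
      ∀ y, y ∈ U := by
    intro U hrot hinv htU
    have hsc : ∀ x y : (M.restrict S).Dart, M.vert x.1 = M.vert y.1 → x ∈ U → y ∈ U :=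
      fun x y hxy hx => Equiv.Perm.SameCycle.mem_of_closed hrot
        (Equiv.Perm.sameCycle_subtypePerm (p := fun d => M.vert d ∈ S)
          (h := fun d => by rw [M.vert_rot]) |>.2 ((M.vert_eq_iff _ _).1 hxy)) hx
    -- The vertices reached by `U`. As `U` is closed under inner edges, edges leaving `T` also leave
    -- `S`, so `T` is again a cut of colour `c`.
    set T : Set M.Vertex := {v | ∃ x ∈ U, M.vert x.1 = v} with hT
    have hTmem : ∀ x : (M.restrict S).Dart, M.vert x.1 ∈ T ↔ x ∈ U := fun x =>
      ⟨fun ⟨y, hy, hyx⟩ => hsc y x hyx hy, fun hx => ⟨x, hx, rfl⟩⟩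
    have hTS : T ⊆ S := by
      rintro _ ⟨x, -, rfl⟩
      exact x.2
    have hcut : M.cutSet T ⊆ M.cutSet S := by
      rintro d ⟨hd, hd'⟩
      refine ⟨hTS hd, fun hdS => hd' ?_⟩
      have h1 := hinv _ ((hTmem ⟨d, hTS hd⟩).1 hd)
      rw [restrict_inv_of_mem (M := M) (A := S) ⟨d, hTS hd⟩ hdS] at h1
      exact (hTmem _).2 h1
    have hcutT : M.IsCut c ρ τ T :=
      ⟨fun hρ => h.1.1 (hTS hρ), ⟨_, htU, ht⟩, fun d hd => h.1.2.2 d (hcut hd)⟩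
    have heq : M.cutSet T = M.cutSet S :=
      Set.eq_of_subset_of_ncard_le hcut (h.2 _ hcutT) (Set.toFinite _)
    by_contra hne
    push Not at hne
    obtain ⟨y, hy⟩ := hne
    -- Minimality gave `T` the same cut-set as `S`. Hence no edge leaves `S \ T`, against the
    -- connectedness of `M`.
    have hWr : ∀ d ∈ {d | M.vert d ∈ S ∧ M.vert d ∉ T},
        M.rot d ∈ {d | M.vert d ∈ S ∧ M.vert d ∉ T} := by
      rintro d hd
      change M.vert _ ∈ S ∧ M.vert _ ∉ T
      rw [M.vert_rot]
      exact hd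
    have hWo : ∀ d ∈ {d | M.vert d ∈ S ∧ M.vert d ∉ T},
        M.opp d ∈ {d | M.vert d ∈ S ∧ M.vert d ∉ T} := by
      rintro d ⟨hdS, hdT⟩
      have h1 : M.vert (M.opp d) ∈ S := by
        by_contra h2
        have h3 : d ∈ M.cutSet S := ⟨hdS, h2⟩
        rw [← heq] at h3
        exact hdT h3.1
      refine ⟨h1, fun h2 => hdT ?_⟩
      have h3 := hinv _ ((hTmem ⟨_, h1⟩).1 h2)
      have h4 : M.vert (M.opp (M.opp d)) ∈ S := by rwa [M.opp_opp]
      rw [restrict_inv_of_mem (M := M) (A := S) ⟨_, h1⟩ h4] at h3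
      have h5 : M.vert (M.opp (M.opp d)) ∈ T := (hTmem ⟨_, h4⟩).2 h3
      rwa [M.opp_opp] at h5
    have := (M.isPlanarMap_iff.1 hM).1 _ hWr hWo y.1 ⟨y.2, mt (hTmem y).1 hy⟩ r
    rw [Set.mem_ofPred_eq, hr] at this
    exact h.1.1 this.1
  refine ⟨⟨⟨t, htS⟩⟩, fun U hrot hinv x hx => ?_⟩
  by_cases htU : (⟨t, htS⟩ : (M.restrict S).Dart) ∈ U
  · exact key U hrot hinv htU
  · refine ((key Uᶜ (fun z hz hz' => hz ?_) (fun z hz hz' => hz ?_) htU) x hx).elim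
    · exact (Equiv.Perm.mem_iff_of_closed hrot z).1 hz'
    · rw [← (M.restrict S).inv_inv z]
      exact hinv _ hz'

theorem IsMinimalCut.restrict_compl_connected (hM : M.IsPlanarMap)
    (h : M.IsMinimalCut c ρ τ S) : (M.restrict Sᶜ).Connected :=
  (isMinimalCut_compl.2 h).restrict_connected hM

theorem IsMinimalCut.cutSet_nonempty (hM : M.IsPlanarMap) (h : M.IsMinimalCut c ρ τ S) :
    (M.cutSet S).Nonempty := by
  by_contra hne
  rw [Set.not_nonempty_iff_eq_empty] at hne
  obtain ⟨t, ht⟩ := exists_vert_eq τ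
  obtain ⟨r, hr⟩ := exists_vert_eq ρ
  have := (M.isPlanarMap_iff.1 hM).1 {d | M.vert d ∈ S}
    (fun d hd => by change M.vert _ ∈ S; rw [M.vert_rot]; exact hd)
    (fun d hd => by
      by_contra h'
      have h1 : d ∈ M.cutSet S := ⟨hd, h'⟩
      rw [hne] at h1
      exact h1) t (show M.vert t ∈ S from ht ▸ h.1.2.1) r
  exact h.1.1 (hr ▸ this)

end RibbonGraph

/-! ### The least minimal black cut -/

namespace DoublyRootedMap

variable (m : DoublyRootedMap)

/-- An inclusion-minimal member of a finite family stable under intersection is its least element,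
hence equals the intersection of the family. -/
theorem Smin_mem_minimalBlackCuts (h : m.minimalBlackCuts.Nonempty) :
    m.Smin ∈ m.minimalBlackCuts := by
  obtain ⟨S, hS⟩ := (Set.toFinite m.minimalBlackCuts).exists_minimal h
  have : m.Smin = S := by
    refine Set.Subset.antisymm (Set.sInter_subset_of_mem hS.1) (Set.subset_sInter fun T hT => ?_)
    have h1 := hS.2 (RibbonGraph.IsMinimalCut.inter hS.1 hT) Set.inter_subset_left
    exact h1.trans Set.inter_subset_right
  rw [this]
  exact hS.1

theorem HasMinBlackCutWeight.Smin_mem {m : DoublyRootedMap} {k : ℕ}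
    (h : m.HasMinBlackCutWeight k) :
    m.Smin ∈ m.minimalBlackCuts ∧ m.M.cutWeight m.Smin = k := by
  obtain ⟨S, hS, rfl⟩ := h
  have h1 := m.Smin_mem_minimalBlackCuts ⟨S, hS⟩
  exact ⟨h1, RibbonGraph.IsMinimalCut.cutWeight_eq h1 hS⟩

end DoublyRootedMap

namespace PointedMap

variable {P : PointedMap}

theorem IsTight.rest_connected (h : P.IsTight) : P.rest.Connected :=
  RibbonGraph.IsMinimalCut.restrict_compl_connected P.planar h

theorem cutWeight_singleton (P : PointedMap) : P.M.cutWeight {P.τ} = P.M.degree P.τ := by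
  unfold RibbonGraph.cutWeight RibbonGraph.degree
  congr 1
  ext d
  exact ⟨fun h => h.1, fun h => ⟨h, P.opp_vert_ne d h⟩⟩

theorem isCut_singleton (P : PointedMap) :
    P.M.IsCut (P.M.vertColour P.τ) P.ρ P.τ {P.τ} :=
  ⟨P.root_ne, rfl, fun _ hd => congrArg P.M.vertColour hd.1⟩

end PointedMap

/-! ### Cuts of a piece -/

section Piece

variable {M : RibbonGraph} {A : Set M.Vertex} {r : M.Dart} {P : PointedMap}

theorem piece_vert_eq_iff (f : {d : M.Dart // M.vert d ∈ A} ≃ {d : P.M.Dart // P.M.vert d ≠ P.τ})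
    (hrot : ∀ x y, y.1 = M.rot x.1 → (f y).1 = P.M.rot (f x).1) (x y) :
    P.M.vert (f x).1 = P.M.vert (f y).1 ↔ M.vert x.1 = M.vert y.1 := by
  classical
  have hr : ∀ d : M.Dart, M.vert d ∈ A → M.vert (M.rot d) ∈ A := fun d h => by rwa [M.vert_rot]
  constructor
  · intro h
    -- The value `none` at half-edges around `τ` makes the function total and rotation-invariant,
    -- hence constant on cycles of `rot`.
    let F : P.M.Dart → Option M.Vertex := fun d =>
      if h : P.M.vert d ≠ P.τ then some (M.vert (f.symm ⟨d, h⟩).1) else none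
    have hF : ∀ x, F (f x).1 = some (M.vert x.1) := fun x => by simp [F, (f x).2]
    have h1 := P.M.eq_of_sameCycle F (fun d => ?_) ((P.M.vert_eq_iff _ _).1 h)
    · rw [hF, hF] at h1
      exact Option.some_injective _ h1
    · by_cases hd : P.M.vert d = P.τ
      · simp [F, P.M.vert_rot, hd]
      · obtain ⟨x, hx⟩ := f.surjective ⟨d, hd⟩
        obtain rfl : (f x).1 = d := congrArg Subtype.val hx
        rw [← hrot x ⟨M.rot x.1, hr _ x.2⟩ rfl, hF, hF, M.vert_rot]
  · intro h
    let F : M.Dart → Option P.M.Vertex := fun d =>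
      if h : M.vert d ∈ A then some (P.M.vert (f ⟨d, h⟩).1) else none
    have hF : ∀ x : {d : M.Dart // M.vert d ∈ A}, F x.1 = some (P.M.vert (f x).1) :=
      fun x => by simp [F, x.2]
    have h1 := M.eq_of_sameCycle F (fun d => ?_) ((M.vert_eq_iff _ _).1 h)
    · rw [hF, hF] at h1
      exact Option.some_injective _ h1
    · by_cases hd : M.vert d ∈ A
      · have h2 := hF ⟨M.rot d, hr _ hd⟩
        rw [h2, hF ⟨d, hd⟩, hrot ⟨d, hd⟩ ⟨M.rot d, hr _ hd⟩ rfl, P.M.vert_rot]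
      · simp [F, M.vert_rot, hd]

/-- The cuts of a piece are the cuts of the map whose part `S` contains the complement of the
piece. -/
theorem IsPiece.exists_cut_equiv (h : IsPiece M A r P) :
    ∃ φ : {S : Set M.Vertex // Aᶜ ⊆ S} ≃ {S' : Set P.M.Vertex // P.τ ∈ S'},
      (φ ⟨Aᶜ, Set.Subset.rfl⟩).1 = {P.τ} ∧
      (∀ S, P.M.cutWeight (φ S).1 = M.cutWeight S.1) ∧
      ∀ c S τ, τ ∉ A → (P.M.IsCut c P.ρ P.τ (φ S).1 ↔ M.IsCut c (M.vert r) τ S.1) := by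
  obtain ⟨f, hrot, hcol, hopp, hstem, hr, hroot⟩ := h
  have hv := piece_vert_eq_iff f hrot
  have hsurj : ∀ d, P.M.vert d ≠ P.τ → ∃ x, (f x).1 = d := fun d hd => by
    obtain ⟨x, hx⟩ := f.surjective ⟨d, hd⟩
    exact ⟨x, congrArg Subtype.val hx⟩
  -- No `f x` is incident to `τ`, so the universal quantifier puts `τ` in every `F S`. For the same
  -- reason `G` puts all of `Aᶜ` in every `G S`.
  let F : Set M.Vertex → Set P.M.Vertex := fun S =>
    {v | ∀ x, P.M.vert (f x).1 = v → M.vert x.1 ∈ S}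
  let G : Set P.M.Vertex → Set M.Vertex := fun S =>
    {v | ∀ x, M.vert x.1 = v → P.M.vert (f x).1 ∈ S}
  have hF : ∀ S x, P.M.vert (f x).1 ∈ F S ↔ M.vert x.1 ∈ S := fun S x =>
    ⟨fun h => h x rfl, fun h y hy => by rwa [(hv y x).1 hy]⟩
  have hG : ∀ S x, M.vert x.1 ∈ G S ↔ P.M.vert (f x).1 ∈ S := fun S x =>
    ⟨fun h => h x rfl, fun h y hy => by rwa [(hv y x).2 hy]⟩
  have hFτ : ∀ S, P.τ ∈ F S := fun S x hx => ((f x).2 hx).elim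
  have hGA : ∀ S, Aᶜ ⊆ G S := fun S v hv x hx => (hv (hx ▸ x.2)).elim
  have hFo : ∀ S, Aᶜ ⊆ S → ∀ x, P.M.vert (P.M.opp (f x).1) ∈ F S ↔ M.vert (M.opp x.1) ∈ S := by
    intro S hS x
    by_cases hx : M.vert (M.opp x.1) ∈ A
    · rw [← hopp x ⟨_, hx⟩ rfl, hF]
    · rw [hstem x hx]
      exact iff_of_true (hFτ S) (hS hx)
  -- Cut edges are taken from the side of `Sᶜ`: those half-edges all lie in `A`, where `f` is
  -- defined, which may fail on the side of `S`.
  let T : Set M.Vertex → Set {d : M.Dart // M.vert d ∈ A} := fun S =>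
    {x | M.vert x.1 ∉ S ∧ M.vert (M.opp x.1) ∈ S}
  have hT1 : ∀ S, Aᶜ ⊆ S → M.cutSet Sᶜ = Subtype.val '' T S := by
    intro S hS
    ext d
    constructor
    · intro hd
      exact ⟨⟨d, by_contra fun h => hd.1 (hS h)⟩, ⟨hd.1, not_not.1 hd.2⟩, rfl⟩
    · rintro ⟨x, hx, rfl⟩
      exact ⟨hx.1, not_not.2 hx.2⟩
  have hT2 : ∀ S, Aᶜ ⊆ S → P.M.cutSet (F S)ᶜ = (fun x => (f x).1) '' T S := by
    intro S hS
    ext d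
    constructor
    · intro hd
      obtain ⟨x, rfl⟩ := hsurj d fun h => hd.1 (h ▸ hFτ S)
      exact ⟨x, ⟨mt (hF S x).2 hd.1, (hFo S hS x).1 (not_not.1 hd.2)⟩, rfl⟩
    · rintro ⟨x, hx, rfl⟩
      exact ⟨mt (hF S x).1 hx.1, not_not.2 ((hFo S hS x).2 hx.2)⟩
  refine ⟨⟨fun S => ⟨F S.1, hFτ _⟩, fun S => ⟨G S.1, hGA _⟩, fun S => ?_, fun S => ?_⟩,
    ?_, fun S => ?_, fun c S τ hτ => ?_⟩
  · ext v
    obtain ⟨d, rfl⟩ := RibbonGraph.exists_vert_eq v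
    by_cases hd : M.vert d ∈ A
    · exact (hG _ ⟨d, hd⟩).trans (hF _ ⟨d, hd⟩)
    · exact iff_of_true (hGA _ hd) (S.2 hd)
  · ext v
    by_cases hτ : v = P.τ
    · rw [hτ]; exact iff_of_true (hFτ _) S.2
    · obtain ⟨d, rfl⟩ := RibbonGraph.exists_vert_eq v
      obtain ⟨x, rfl⟩ := hsurj d hτ
      exact (hF _ x).trans (hG _ x)
  · ext v
    by_cases hτ : v = P.τ
    · rw [hτ]; exact iff_of_true (hFτ _) rfl
    · obtain ⟨d, rfl⟩ := RibbonGraph.exists_vert_eq v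
      obtain ⟨x, rfl⟩ := hsurj d hτ
      exact iff_of_false (fun h => (hF _ x).1 h x.2) hτ
  · change P.M.cutWeight (F S.1) = _
    rw [← RibbonGraph.cutWeight_compl, ← RibbonGraph.cutWeight_compl S.1, RibbonGraph.cutWeight,
      RibbonGraph.cutWeight, hT1 _ S.2, hT2 _ S.2,
      Set.ncard_image_of_injective _ Subtype.val_injective]
    exact Set.ncard_image_of_injective _ (Subtype.val_injective.comp f.injective)
  · change P.M.IsCut c P.ρ P.τ (F S.1) ↔ _
    rw [← RibbonGraph.isCut_compl, ← RibbonGraph.isCut_compl (S := S.1)]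
    unfold RibbonGraph.IsCut
    rw [compl_compl, compl_compl, hT1 _ S.2, hT2 _ S.2, Set.forall_mem_image,
      Set.forall_mem_image]
    refine and_congr (iff_of_true (hFτ _) (S.2 hτ)) (and_congr ?_ ?_)
    · have h1 : P.ρ = P.M.vert (f ⟨r, hr⟩).1 := by rw [hroot]; rfl
      rw [h1]
      exact not_congr (hF _ _)
    · refine forall_congr' fun x => imp_congr_right fun _ => ?_
      change P.M.colour _ = _ ↔ M.colour _ = _
      rw [hcol]

end Piece

/-! ### Tightness of the two pieces -/

open RibbonGraph in
/-- If a map is cut into a d-trumpet and a d-cornet along `S`, then `S` is its minimal black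
cut. -/
theorem Smin_eq_of_isPiece {k : ℕ} (t : Trumpet k) (c : Cornet k) {m : DoublyRootedMap}
    {S₀ : Set m.M.Vertex} (ht : IsPiece m.M S₀ᶜ m.corner₁ t.1)
    (hc : IsPiece m.M S₀ m.corner₂ c.1) : m.Smin = S₀ ∧ m.HasMinBlackCutWeight k := by
  have hρ₁ : m.ρ₁ ∉ S₀ := by obtain ⟨f, -, -, -, -, h, -⟩ := ht; exact h
  have hρ₂ : m.ρ₂ ∈ S₀ := by obtain ⟨f, -, -, -, -, h, -⟩ := hc; exact h
  obtain ⟨φ, hφτ, hφw, hφ⟩ := ht.exists_cut_equiv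
  obtain ⟨ψ, hψτ, hψw, hψ⟩ := hc.exists_cut_equiv
  have hwt := t.1.cutWeight_singleton.trans t.2.2
  have hwc := c.1.cutWeight_singleton.trans c.2.2
  have hw₀ : m.M.cutWeight S₀ = k := by
    have := hφw ⟨S₀ᶜᶜ, Set.Subset.rfl⟩
    rwa [hφτ, hwt, compl_compl, eq_comm] at this
  have hcut₀ : m.M.IsCut Colour.black m.ρ₁ m.ρ₂ S₀ := by
    have := (hφ Colour.black ⟨S₀ᶜᶜ, Set.Subset.rfl⟩ m.ρ₂ (not_not.2 hρ₂)).1 (by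
      rw [hφτ, ← t.2.1.2]
      exact t.1.isCut_singleton)
    rwa [compl_compl] at this
  -- Black cuts containing `S₀` live in the d-trumpet, whose tightness bounds them.
  have outer : ∀ S, m.M.IsCut Colour.black m.ρ₁ m.ρ₂ S → S₀ ⊆ S → k ≤ m.M.cutWeight S := by
    intro S hS hS₀
    have hS₀' : S₀ᶜᶜ ⊆ S := by rwa [compl_compl]
    have h1 := (hφ Colour.black ⟨S, hS₀'⟩ m.ρ₂ (not_not.2 hρ₂)).2 hS
    rw [← t.2.1.2] at h1
    have h2 := t.2.1.1.2 _ h1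
    rwa [hwt, hφw] at h2
  -- Complements of black cuts inside `S₀` are white cuts in the d-cornet; strict tightness also
  -- gives the case of equality.
  have inner : ∀ S, m.M.IsCut Colour.black m.ρ₁ m.ρ₂ S → S ⊆ S₀ →
      k ≤ m.M.cutWeight S ∧ (m.M.cutWeight S = k → S = S₀) := by
    intro S hS hS₀
    have hS₀' : S₀ᶜ ⊆ Sᶜ := Set.compl_subset_compl.2 hS₀
    have h1 := (hψ Colour.white ⟨Sᶜ, hS₀'⟩ m.ρ₁ hρ₁).2 (isCut_compl.2 hS)
    rw [← c.2.1.2] at h1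
    have h2 := c.2.1.1.1.2 _ h1
    rw [hwc, hψw, cutWeight_compl] at h2
    refine ⟨h2, fun h3 => ?_⟩
    have h4 := c.2.1.1.2 _ ⟨h1, fun T hT => by
      rw [hψw, cutWeight_compl, h3]
      exact hwc.ge.trans (c.2.1.1.1.2 T hT)⟩
    rw [← hψτ] at h4
    exact compl_injective (congrArg Subtype.val (ψ.injective (Subtype.ext h4)))
  have hmin : m.M.IsMinimalCut Colour.black m.ρ₁ m.ρ₂ S₀ ∧
      ∀ S, m.M.IsMinimalCut Colour.black m.ρ₁ m.ρ₂ S → S₀ ⊆ S := by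
    have key : ∀ S, m.M.IsCut Colour.black m.ρ₁ m.ρ₂ S →
        k ≤ m.M.cutWeight S ∧ (m.M.cutWeight S = k → S₀ ⊆ S) := by
      -- Submodularity compares `S` with `S₀`: the union is bounded by `outer` and the intersection
      -- by `inner`.
      intro S hS
      have h1 := cutWeight_inter_add_union_le S S₀
      have h2 := outer _ (hS.union hcut₀) Set.subset_union_right
      obtain ⟨h3, h4⟩ := inner _ (hS.inter hcut₀) Set.inter_subset_right
      exact ⟨by omega, fun h5 => Set.inter_eq_right.1 (h4 (by omega))⟩
    refine ⟨⟨hcut₀, fun S hS => hw₀ ▸ (key S hS).1⟩, fun S hS => (key S hS.1).2 ?_⟩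
    exact le_antisymm (hw₀ ▸ hS.2 _ hcut₀) (key S hS.1).1
  exact ⟨Set.Subset.antisymm (Set.sInter_subset_of_mem hmin.1) (Set.subset_sInter hmin.2),
    S₀, hmin.1, hw₀⟩

/-- A black cut of the piece is a black cut of `m` containing `Smin`, so it weighs at least `k`, the
weight of the trivial cut. -/
theorem isTrumpet_of_isPiece {k : ℕ} {m : DoublyRootedMap} (hm : m.HasMinBlackCutWeight k)
    {P : PointedMap} (hP : IsPiece m.M m.Rmin m.corner₁ P)
    (hcol : P.M.vertColour P.τ = Colour.black) : P.IsTrumpet ∧ P.M.degree P.τ = k := by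
  obtain ⟨hmin, hw⟩ := hm.Smin_mem
  obtain ⟨φ, hφτ, hφw, hφ⟩ := hP.exists_cut_equiv
  have hρ₂ : m.ρ₂ ∉ m.Rmin := not_not.2 hmin.1.2.1
  have hdeg : P.M.cutWeight {P.τ} = k := by
    have := hφw ⟨m.Rminᶜ, Set.Subset.rfl⟩
    rw [hφτ] at this
    rw [this, ← hw, DoublyRootedMap.Rmin, compl_compl]
  refine ⟨⟨⟨P.isCut_singleton, fun S hS => ?_⟩, hcol⟩, P.cutWeight_singleton ▸ hdeg⟩
  obtain ⟨T, hT⟩ := φ.surjective ⟨S, hS.2.1⟩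
  obtain rfl : (φ T).1 = S := congrArg Subtype.val hT
  rw [hcol] at hS
  rw [hφw, hdeg, ← hw]
  exact hmin.2 _ ((hφ _ _ _ hρ₂).1 hS)

/-- White cuts of the piece are complements of black cuts inside `Smin`. One of minimal weight comes
from a minimal black cut, which also contains `Smin`; this gives uniqueness. -/
theorem isCornet_of_isPiece {k : ℕ} {m : DoublyRootedMap} (hm : m.HasMinBlackCutWeight k)
    {P : PointedMap} (hP : IsPiece m.M m.Smin m.corner₂ P)
    (hcol : P.M.vertColour P.τ = Colour.white) : P.IsCornet ∧ P.M.degree P.τ = k := by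
  obtain ⟨hmin, hw⟩ := hm.Smin_mem
  obtain ⟨φ, hφτ, hφw, hφ⟩ := hP.exists_cut_equiv
  have hρ₁ : m.ρ₁ ∉ m.Smin := hmin.1.1
  have hdeg : P.M.cutWeight {P.τ} = k := by
    have := hφw ⟨m.Sminᶜ, Set.Subset.rfl⟩
    rw [hφτ] at this
    rw [this, ← hw, RibbonGraph.cutWeight_compl]
  have hcut : ∀ T, P.M.IsCut Colour.white P.ρ P.τ (φ T).1 →
      m.M.IsCut Colour.black m.ρ₁ m.ρ₂ T.1ᶜ := by
    intro T hT
    have := (hφ _ _ _ hρ₁).1 hT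
    exact RibbonGraph.isCut_compl.1 (by rw [compl_compl]; exact this)
  have htight : P.IsTight := by
    refine ⟨P.isCut_singleton, fun S hS => ?_⟩
    obtain ⟨T, hT⟩ := φ.surjective ⟨S, hS.2.1⟩
    obtain rfl : (φ T).1 = S := congrArg Subtype.val hT
    rw [hcol] at hS
    rw [hφw, hdeg, ← hw, ← RibbonGraph.cutWeight_compl T.1]
    exact hmin.2 _ (hcut T hS)
  refine ⟨⟨⟨htight, fun S hS => ?_⟩, hcol⟩, P.cutWeight_singleton ▸ hdeg⟩
  obtain ⟨T, hT⟩ := φ.surjective ⟨S, hS.1.2.1⟩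
  obtain rfl : (φ T).1 = S := congrArg Subtype.val hT
  have h1 : m.M.cutWeight T.1ᶜ = k := by
    rw [RibbonGraph.cutWeight_compl, ← hφw, ← hdeg]
    exact hS.cutWeight_eq htight
  have h2 : T.1ᶜ ∈ m.minimalBlackCuts :=
    ⟨hcut T (by have := hS.1; rwa [hcol] at this), fun S' hS' => by
      rw [h1, ← hw]; exact hmin.2 _ hS'⟩
  have h3 : m.Smin ⊆ T.1ᶜ := Set.sInter_subset_of_mem h2
  have h4 : T = ⟨m.Sminᶜ, Set.Subset.rfl⟩ :=
    Subtype.ext (Set.Subset.antisymm (Set.subset_compl_comm.1 h3) T.2)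
  rw [h4, hφτ]

/-! ### Closing the stems of a restriction -/

section Cap

open Classical in
/-- The involution connecting each stem to a new half-edge. -/
noncomputable def StemMap.capOpp (X : StemMap) : X.Dart ⊕ X.Stem → X.Dart ⊕ X.Stem :=
  Sum.elim (fun x => if h : X.inv x = x then Sum.inr ⟨x, h⟩ else Sum.inl (X.inv x))
    fun s => Sum.inl s.1

theorem StemMap.capOpp_stem (X : StemMap) (s : X.Stem) : X.capOpp (Sum.inl s.1) = Sum.inr s :=
  dif_pos s.2

theorem StemMap.capOpp_of_ne (X : StemMap) (x : X.Dart) (h : X.inv x ≠ x) :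
    X.capOpp (Sum.inl x) = Sum.inl (X.inv x) :=
  dif_neg h

theorem StemMap.capOpp_involutive (X : StemMap) : Function.Involutive X.capOpp := by
  rintro (x | s)
  · by_cases h : X.inv x = x
    · rw [X.capOpp_stem ⟨x, h⟩]
      rfl
    · rw [X.capOpp_of_ne x h, X.capOpp_of_ne _ fun h' => h (X.inv.injective h'), X.inv_inv]
  · exact X.capOpp_stem s

variable (M : RibbonGraph) (A : Set M.Vertex) (c : Colour)
  (hA : ∀ d ∈ M.cutSet A, M.colour d = c)

/-- Connect the half-edges leaving `A` to a new vertex. -/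
noncomputable def cap : RibbonGraph where
  Dart := (M.restrict A).Dart ⊕ (M.restrict A).Stem
  finite := inferInstance
  -- The inverse is the order reversal required for planarity by `Gluing.isPlanarMap_star_iff`.
  rot := Equiv.sumCongr (M.restrict A).rot (M.restrict A).nextStem⁻¹
  opp := (M.restrict A).capOpp_involutive.toPerm
  opp_opp := (M.restrict A).capOpp_involutive
  colour := Sum.elim (fun x => M.colour x.1) fun _ => c.flip
  colour_rot := by
    rintro (x | s)
    · exact M.colour_rot x.1
    · rfl
  colour_opp := by
    have hs : ∀ x : (M.restrict A).Dart, (M.restrict A).inv x = x → M.colour x.1 ≠ c.flip := by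
      intro x hx
      rw [hA x.1 ⟨x.2, (RibbonGraph.restrict_inv_eq_iff x).1 hx⟩]
      cases c <;> exact Colour.noConfusion
    rintro (x | s)
    · change Sum.elim (fun x : (M.restrict A).Dart => M.colour x.1) (fun _ => c.flip)
        ((M.restrict A).capOpp (Sum.inl x)) ≠ M.colour x.1
      by_cases h : (M.restrict A).inv x = x
      · rw [StemMap.capOpp_stem _ ⟨x, h⟩]
        exact (hs x h).symm
      · rw [StemMap.capOpp_of_ne _ x h,
          RibbonGraph.restrict_inv_of_mem x
            (not_not.1 (mt (RibbonGraph.restrict_inv_eq_iff x).2 h))]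
        exact M.colour_opp x.1
    · exact hs s.1 s.2

theorem cap_opp_inl_of_ne (x : (M.restrict A).Dart) (h : (M.restrict A).inv x ≠ x) :
    (cap M A c hA).opp (Sum.inl x) = Sum.inl ((M.restrict A).inv x) :=
  StemMap.capOpp_of_ne _ x h

theorem cap_opp_stem (s : (M.restrict A).Stem) :
    (cap M A c hA).opp (Sum.inl s.1) = Sum.inr s :=
  StemMap.capOpp_stem _ s

/-- The closed restriction is a gluing of the restriction and a star. -/
noncomputable def capGluing : Gluing (cap M A c hA) (M.restrict A)
    (StemMap.star (M.restrict A).Stem (M.restrict A).nextStem⁻¹) where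
  e := Equiv.refl _
  γ := (Equiv.subtypeUnivEquiv fun _ => rfl).symm
  rot_inl _ := rfl
  rot_inr _ := rfl
  opp_inl x h := cap_opp_inl_of_ne M A c hA x h
  opp_inr _ h := (h rfl).elim
  opp_stem s := cap_opp_stem M A c hA s

variable {M A c}

/-- Applied to `M` as the gluing of its two restrictions, the planarity criterion shows that the
side `A` is planar with all stems along one face. This is what closing it by a new vertex requires.
-/
theorem exists_isPiece (hA : ∀ d ∈ M.cutSet A, M.colour d = c) (hM : M.IsPlanarMap)
    (h₁ : (M.restrict A).Connected) (h₂ : (M.restrict Aᶜ).Connected) (hne : (M.cutSet A).Nonempty) {r : M.Dart}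
    (hr : M.vert r ∈ A) : ∃ P, IsPiece M A r P ∧ P.M.vertColour P.τ = c.flip := by
  obtain ⟨d₀, hd₀⟩ := hne
  let s₀ : (M.restrict A).Stem := ⟨⟨d₀, hd₀.1⟩, (RibbonGraph.restrict_inv_eq_iff _).2 hd₀.2⟩
  have hs₀ : Nonempty (M.restrict A).Stem := ⟨s₀⟩
  obtain ⟨p1, -, p2, -, -⟩ := ((M.restrictGluing A).isPlanarMap_iff h₁ h₂ hs₀).1 hM
  have hsc : ∀ x y, (M.restrict A).nextStem⁻¹.SameCycle x y := fun x y =>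
    Equiv.Perm.sameCycle_inv.2 ((numCycles_eq_one_iff _).1 p2 x y)
  have hplanar : (cap M A c hA).IsPlanarMap :=
    ((capGluing M A c hA).isPlanarMap_star_iff h₁ hsc).2 ⟨p1, p2, fun _ => rfl⟩
  have hτ : ∀ s, (cap M A c hA).vert (Sum.inr s) = (cap M A c hA).vert (Sum.inr s₀) := fun s =>
    ((cap M A c hA).vert_eq_iff _ _).2
      (Equiv.Perm.SameCycle.map (g := (cap M A c hA).rot) Sum.inr (fun x => ⟨1, rfl⟩) (hsc s s₀))
  have hne : ∀ x, (cap M A c hA).vert (Sum.inl x) ≠ (cap M A c hA).vert (Sum.inr s₀) := by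
    intro x h
    have hl : ∀ z : (M.restrict A).Dart ⊕ (M.restrict A).Stem,
        Sum.isLeft ((cap M A c hA).rot z) = z.isLeft := by
      rintro (z | z) <;> rfl
    exact Bool.noConfusion ((cap M A c hA).eq_of_sameCycle
      (fun z : (M.restrict A).Dart ⊕ (M.restrict A).Stem => z.isLeft) hl
      (((cap M A c hA).vert_eq_iff _ _).1 h))
  let P : PointedMap := ⟨cap M A c hA, hplanar, Sum.inl ⟨r, hr⟩,
    (cap M A c hA).vert (Sum.inr s₀), hne _⟩
  let f : {d : M.Dart // M.vert d ∈ A} → {d : P.M.Dart // P.M.vert d ≠ P.τ} :=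
    fun x => ⟨Sum.inl x, hne x⟩
  have hf : Function.Bijective f := by
    refine ⟨fun x y h => Sum.inl_injective (congrArg Subtype.val h), ?_⟩
    rintro ⟨x | s, h⟩
    · exact ⟨x, rfl⟩
    · exact (h (hτ s)).elim
  refine ⟨P, ⟨Equiv.ofBijective f hf, ?_, fun _ => rfl, ?_, ?_, hr, rfl⟩, rfl⟩
  · rintro x ⟨_, hy⟩ rfl
    rfl
  · rintro x ⟨_, hy⟩ rfl
    have h : (M.restrict A).inv x ≠ x := fun h => (RibbonGraph.restrict_inv_eq_iff x).1 h hy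
    refine Eq.trans ?_ (cap_opp_inl_of_ne M A c hA x h).symm
    rw [RibbonGraph.restrict_inv_of_mem x hy]
    rfl
  · intro x hx
    have h : (M.restrict A).inv x = x := (RibbonGraph.restrict_inv_eq_iff x).2 hx
    exact (congrArg (cap M A c hA).vert (cap_opp_stem M A c hA ⟨x, h⟩)).trans (hτ _)

end Cap

theorem exists_cutsInto {k : ℕ} (m : DoublyRooted k) :
    ∃ (t : Trumpet k) (c : Cornet k), CutsInto m.1 t.1 c.1 := by
  have hmin := m.2.Smin_mem.1
  have hS : ∀ d ∈ m.1.M.cutSet m.1.Smin, m.1.M.colour d = Colour.black := hmin.1.2.2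
  have hR : ∀ d ∈ m.1.M.cutSet m.1.Rmin, m.1.M.colour d = Colour.white :=
    (RibbonGraph.isCut_compl.2 hmin.1).2.2
  have cS := hmin.restrict_connected m.1.planar
  have cR := hmin.restrict_compl_connected m.1.planar
  have nS := hmin.cutSet_nonempty m.1.planar
  have nR := (RibbonGraph.isMinimalCut_compl.2 hmin).cutSet_nonempty m.1.planar
  obtain ⟨P, hP, hPc⟩ := exists_isPiece hR m.1.planar cR
    (by rw [DoublyRootedMap.Rmin, compl_compl]; exact cS) nR (r := m.1.corner₁) hmin.1.1
  obtain ⟨Q, hQ, hQc⟩ := exists_isPiece hS m.1.planar cS cR nS (r := m.1.corner₂) hmin.1.2.1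
  exact ⟨⟨P, isTrumpet_of_isPiece m.2 hP hPc⟩, ⟨Q, isCornet_of_isPiece m.2 hQ hQc⟩, hP, hQ⟩

/-! ### Isomorphisms and pieces -/

theorem RibbonGraph.Iso.vert_eq_iff {M N : RibbonGraph} (e : RibbonGraph.Iso M N) (x y : M.Dart) :
    N.vert (e.toEquiv x) = N.vert (e.toEquiv y) ↔ M.vert x = M.vert y := by
  have key : ∀ {M N : RibbonGraph} (e : RibbonGraph.Iso M N) (x y : M.Dart),
      M.vert x = M.vert y → N.vert (e.toEquiv x) = N.vert (e.toEquiv y) := by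
    intro M N e x y h
    rw [RibbonGraph.vert_eq_iff] at h ⊢
    exact h.map e.toEquiv fun x => ⟨1, by rw [zpow_one]; exact (e.map_rot x).symm⟩
  refine ⟨fun h => ?_, key e x y⟩
  have := key e.symm _ _ h
  simpa [RibbonGraph.Iso.symm] using this

theorem RibbonGraph.Iso.isPlanarMap {M N : RibbonGraph} (e : RibbonGraph.Iso M N)
    (h : M.IsPlanarMap) : N.IsPlanarMap := by
  rw [RibbonGraph.isPlanarMap_iff] at h ⊢
  refine ⟨fun U h1 h2 x hx y => ?_, ?_⟩
  · have := h.1 {d | e.toEquiv d ∈ U}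
      (fun d hd => by change e.toEquiv _ ∈ U; rw [e.map_rot]; exact h1 _ hd)
      (fun d hd => by change e.toEquiv _ ∈ U; rw [e.map_opp]; exact h2 _ hd)
      (e.toEquiv.symm x) (by simpa using hx) (e.toEquiv.symm y)
    simpa using this
  · rw [← numCycles_congr e.toEquiv e.map_rot, ← numCycles_congr e.toEquiv e.map_opp,
      ← numCycles_congr (f := M.rot * M.opp) e.toEquiv fun x => by
        rw [Equiv.Perm.mul_apply, Equiv.Perm.mul_apply, e.map_rot, e.map_opp],
      ← Nat.card_congr e.toEquiv]
    exact h.2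

/-- The identification of the half-edges incident to `A` with those of a piece, away from its
marked vertex. -/
structure PieceEquiv (M : RibbonGraph) (A : Set M.Vertex) (P : PointedMap) where
  toEquiv : {d : M.Dart // M.vert d ∈ A} ≃ P.Rest
  map_rot : ∀ x y, y.1 = M.rot x.1 → (toEquiv y).1 = P.M.rot (toEquiv x).1
  map_colour : ∀ x, P.M.colour (toEquiv x).1 = M.colour x.1
  map_opp : ∀ x y, y.1 = M.opp x.1 → (toEquiv y).1 = P.M.opp (toEquiv x).1
  map_stem : ∀ x, M.vert (M.opp x.1) ∉ A → P.M.vert (P.M.opp (toEquiv x).1) = P.τ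

theorem isPiece_iff {M : RibbonGraph} {A : Set M.Vertex} {r : M.Dart} {P : PointedMap} :
    IsPiece M A r P ↔
      ∃ f : PieceEquiv M A P, ∃ h : M.vert r ∈ A, (f.toEquiv ⟨r, h⟩).1 = P.corner :=
  ⟨fun ⟨f, h1, h2, h3, h4, h5⟩ => ⟨⟨f, h1, h2, h3, h4⟩, h5⟩,
    fun ⟨f, h5⟩ => ⟨f.toEquiv, f.map_rot, f.map_colour, f.map_opp, f.map_stem, h5⟩⟩

namespace PieceEquiv

variable {M : RibbonGraph} {A : Set M.Vertex} {P : PointedMap} (f : PieceEquiv M A P)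

theorem vert_opp_eq_iff (x) : P.M.vert (P.M.opp (f.toEquiv x).1) = P.τ ↔
    M.vert (M.opp x.1) ∉ A := by
  refine ⟨fun h hx => ?_, f.map_stem x⟩
  rw [← f.map_opp x ⟨_, hx⟩ rfl] at h
  exact (f.toEquiv ⟨_, hx⟩).2 h

/-- The half-edges incident to the marked vertex of a piece correspond to the half-edges
leaving `A`. -/
def tauEquiv : P.TauDart ≃ M.cutSet A where
  toFun d := ⟨(f.toEquiv.symm ⟨P.M.opp d.1, P.opp_vert_ne d.1 d.2⟩).1,
    (f.toEquiv.symm _).2, by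
      rw [← f.vert_opp_eq_iff, Equiv.apply_symm_apply, P.M.opp_opp]
      exact d.2⟩
  invFun x := ⟨P.M.opp (f.toEquiv ⟨x.1, x.2.1⟩).1, f.map_stem _ x.2.2⟩
  left_inv d := Subtype.ext (by simp [P.M.opp_opp])
  right_inv x := Subtype.ext (by simp [P.M.opp_opp])

theorem tauEquiv_symm_coe (x : M.cutSet A) :
    (f.tauEquiv.symm x).1 = P.M.opp (f.toEquiv ⟨x.1, x.2.1⟩).1 := rfl

theorem opp_toEquiv (x : {d : M.Dart // M.vert d ∈ A}) (h : M.vert (M.opp x.1) ∉ A) :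
    P.M.opp (f.toEquiv x).1 = (f.tauEquiv.symm ⟨x.1, x.2, h⟩).1 := rfl

theorem opp_tauEquiv_symm (x : M.cutSet A) :
    P.M.opp (f.tauEquiv.symm x).1 = (f.toEquiv ⟨x.1, x.2.1⟩).1 := by
  rw [tauEquiv_symm_coe, P.M.opp_opp]

end PieceEquiv

/-- Reversal of the half-edges of a cut-set. -/
def cutSetOpp (M : RibbonGraph) (S : Set M.Vertex) : M.cutSet Sᶜ ≃ M.cutSet S :=
  M.opp.subtypeEquiv fun _ => RibbonGraph.mem_cutSet_compl

/-- The matching of the stems of two complementary pieces given by the cut edges. -/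
def pieceMatching {M : RibbonGraph} {S : Set M.Vertex} {P Q : PointedMap}
    (f : PieceEquiv M Sᶜ P) (g : PieceEquiv M S Q) : Matching P Q :=
  f.tauEquiv.trans ((cutSetOpp M S).trans g.tauEquiv.symm)

/-! ### A map as the gluing of its two pieces -/

section GlueIso

variable {M : RibbonGraph} {S : Set M.Vertex} {P Q : PointedMap} (f : PieceEquiv M Sᶜ P)
  (g : PieceEquiv M S Q) (hc : P.M.vertColour P.τ ≠ Q.M.vertColour Q.τ)

theorem pieceMatching_tauEquiv_symm (x : M.cutSet Sᶜ) :
    pieceMatching f g (f.tauEquiv.symm x) = g.tauEquiv.symm (cutSetOpp M S x) := by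
  simp [pieceMatching]

theorem glue_opp_inl_toEquiv (x) (h : M.vert (M.opp x.1) ∈ Sᶜ) :
    (glue P Q hc (pieceMatching f g)).opp (Sum.inl (f.toEquiv x)) =
      Sum.inl (f.toEquiv ⟨_, h⟩) := by
  have h1 : P.M.vert (P.M.opp (f.toEquiv x).1) ≠ P.τ := fun h' => (f.vert_opp_eq_iff x).1 h' h
  refine (glueHalf_inner P Q _ _ h1).trans (congrArg Sum.inl (Subtype.ext ?_))
  exact (f.map_opp x ⟨_, h⟩ rfl).symm

theorem glue_opp_inr_toEquiv (y) (h : M.vert (M.opp y.1) ∈ S) :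
    (glue P Q hc (pieceMatching f g)).opp (Sum.inr (g.toEquiv y)) =
      Sum.inr (g.toEquiv ⟨_, h⟩) := by
  have h1 : Q.M.vert (Q.M.opp (g.toEquiv y).1) ≠ Q.τ := fun h' => (g.vert_opp_eq_iff y).1 h' h
  refine (congrArg Sum.swap (glueHalf_inner Q P _ _ h1)).trans
    (congrArg Sum.inr (Subtype.ext ?_))
  exact (g.map_opp y ⟨_, h⟩ rfl).symm

theorem glue_opp_stem_toEquiv (x) (h : M.vert (M.opp x.1) ∈ S) :
    (glue P Q hc (pieceMatching f g)).opp (Sum.inl (f.toEquiv x)) =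
      Sum.inr (g.toEquiv ⟨_, h⟩) := by
  have h0 : M.vert (M.opp x.1) ∉ Sᶜ := not_not.2 h
  refine (glueHalf_stem P Q _ _ (f.map_stem x h0)).trans (congrArg Sum.inr (Subtype.ext ?_))
  have h1 := pieceMatching_tauEquiv_symm f g ⟨x.1, x.2, h0⟩
  have h2 := congrArg (fun d => Q.M.opp d.1) h1
  exact h2.trans (g.opp_tauEquiv_symm _)

open Classical in
/-- The half-edges of a map in terms of those of complementary pieces. -/
noncomputable def glueDartEquiv : (glue P Q hc (pieceMatching f g)).Dart ≃ M.Dart :=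
  ((Equiv.sumCongr f.toEquiv g.toEquiv).symm.trans (Equiv.sumComm _ _)).trans
    (Equiv.sumCompl fun d => M.vert d ∈ S)

theorem glueDartEquiv_inl (x) : glueDartEquiv f g hc (Sum.inl (f.toEquiv x)) = x.1 :=
  congrArg Subtype.val (f.toEquiv.symm_apply_apply x)

theorem glueDartEquiv_inr (y) : glueDartEquiv f g hc (Sum.inr (g.toEquiv y)) = y.1 :=
  congrArg Subtype.val (g.toEquiv.symm_apply_apply y)

/-- A map is isomorphic to the gluing of complementary pieces. -/
noncomputable def glueIso : RibbonGraph.Iso (glue P Q hc (pieceMatching f g)) M where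
  toEquiv := glueDartEquiv f g hc
  map_rot := by
    rintro (x | y)
    · obtain ⟨x, rfl⟩ := f.toEquiv.surjective x
      have hx : M.vert (M.rot x.1) ∈ Sᶜ := by rw [M.vert_rot]; exact x.2
      have h : (glue P Q hc (pieceMatching f g)).rot (Sum.inl (f.toEquiv x)) =
          Sum.inl (f.toEquiv ⟨_, hx⟩) :=
        congrArg Sum.inl (Subtype.ext (f.map_rot x ⟨_, hx⟩ rfl).symm)
      rw [h, glueDartEquiv_inl, glueDartEquiv_inl]
    · obtain ⟨y, rfl⟩ := g.toEquiv.surjective y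
      have hy : M.vert (M.rot y.1) ∈ S := by rw [M.vert_rot]; exact y.2
      have h : (glue P Q hc (pieceMatching f g)).rot (Sum.inr (g.toEquiv y)) =
          Sum.inr (g.toEquiv ⟨_, hy⟩) :=
        congrArg Sum.inr (Subtype.ext (g.map_rot y ⟨_, hy⟩ rfl).symm)
      rw [h, glueDartEquiv_inr, glueDartEquiv_inr]
  map_opp := by
    rintro (x | y)
    · obtain ⟨x, rfl⟩ := f.toEquiv.surjective x
      by_cases h : M.vert (M.opp x.1) ∈ S
      · rw [glue_opp_stem_toEquiv f g hc x h, glueDartEquiv_inl, glueDartEquiv_inr]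
      · rw [glue_opp_inl_toEquiv f g hc x h, glueDartEquiv_inl, glueDartEquiv_inl]
    · obtain ⟨y, rfl⟩ := g.toEquiv.surjective y
      by_cases h : M.vert (M.opp y.1) ∈ S
      · rw [glue_opp_inr_toEquiv f g hc y h, glueDartEquiv_inr, glueDartEquiv_inr]
      -- A cut edge seen from `S`: apply the involution to the statement known from the other end.
      · have h1 := glue_opp_stem_toEquiv f g hc ⟨M.opp y.1, h⟩ (by rw [M.opp_opp]; exact y.2)
        simp only [M.opp_opp, Subtype.coe_eta] at h1
        have h2 := (congrArg (glue P Q hc (pieceMatching f g)).opp h1).symm.trans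
          ((glue P Q hc (pieceMatching f g)).opp_opp _)
        rw [h2, glueDartEquiv_inl, glueDartEquiv_inr]
  map_colour := by
    rintro (x | y)
    · obtain ⟨x, rfl⟩ := f.toEquiv.surjective x
      rw [glueDartEquiv_inl]
      exact (f.map_colour x).symm
    · obtain ⟨y, rfl⟩ := g.toEquiv.surjective y
      rw [glueDartEquiv_inr]
      exact (g.map_colour y).symm

end GlueIso

/-- The pieces of the gluing of `P` and `Q` are `P` and `Q`. -/
theorem exists_isPiece_of_iso {M : RibbonGraph} {P Q : PointedMap}
    {hc : P.M.vertColour P.τ ≠ Q.M.vertColour Q.τ} {β : Matching P Q}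
    (e : RibbonGraph.Iso M (glue P Q hc β)) {r₁ r₂ : M.Dart}
    (h₁ : e.toEquiv r₁ = Sum.inl ⟨P.corner, P.root_ne⟩)
    (h₂ : e.toEquiv r₂ = Sum.inr ⟨Q.corner, Q.root_ne⟩) :
    ∃ S : Set M.Vertex, IsPiece M Sᶜ r₁ P ∧ IsPiece M S r₂ Q := by
  let S : Set M.Vertex := {v | ∃ y, M.vert (e.toEquiv.symm (Sum.inr y)) = v}
  have hr : ∀ y, M.vert (e.toEquiv.symm (Sum.inr y)) ∈ S := fun y => ⟨y, rfl⟩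
  have hl : ∀ x, M.vert (e.toEquiv.symm (Sum.inl x)) ∈ Sᶜ := by
    rintro x ⟨y, h⟩
    have h' := (congrArg (glue P Q hc β).vert (e.toEquiv.apply_symm_apply (Sum.inr y))).symm.trans
      (((e.vert_eq_iff _ _).2 h).trans
        (congrArg (glue P Q hc β).vert (e.toEquiv.apply_symm_apply (Sum.inl x))))
    exact glue_vert_ne P Q hc β _ _ h'.symm
  let F : P.Rest → {d : M.Dart // M.vert d ∈ Sᶜ} := fun x => ⟨e.toEquiv.symm (Sum.inl x), hl x⟩
  let G : Q.Rest → {d : M.Dart // M.vert d ∈ S} := fun y => ⟨e.toEquiv.symm (Sum.inr y), hr y⟩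
  have hF : Function.Bijective F := by
    refine ⟨fun x y h => Sum.inl_injective (e.toEquiv.symm.injective (congrArg Subtype.val h)), ?_⟩
    rintro ⟨d, hd⟩
    obtain ⟨x | y, rfl⟩ := e.toEquiv.symm.surjective d
    · exact ⟨x, rfl⟩
    · exact (hd (hr y)).elim
  have hG : Function.Bijective G := by
    refine ⟨fun x y h => Sum.inr_injective (e.toEquiv.symm.injective (congrArg Subtype.val h)), ?_⟩
    rintro ⟨d, hd⟩
    obtain ⟨x | y, rfl⟩ := e.toEquiv.symm.surjective d
    · exact (hl x hd).elim
    · exact ⟨y, rfl⟩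
  let f := (Equiv.ofBijective F hF).symm
  let g := (Equiv.ofBijective G hG).symm
  have hf : ∀ x, e.toEquiv x.1 = Sum.inl (f x) := fun x => by
    obtain ⟨y, rfl⟩ := (Equiv.ofBijective F hF).surjective x
    rw [Equiv.symm_apply_apply]
    exact e.toEquiv.apply_symm_apply _
  have hg : ∀ x, e.toEquiv x.1 = Sum.inr (g x) := fun x => by
    obtain ⟨y, rfl⟩ := (Equiv.ofBijective G hG).surjective x
    rw [Equiv.symm_apply_apply]
    exact e.toEquiv.apply_symm_apply _
  refine ⟨S, isPiece_iff.2 ⟨⟨f, ?_, ?_, ?_, ?_⟩, ?_, ?_⟩,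
    isPiece_iff.2 ⟨⟨g, ?_, ?_, ?_, ?_⟩, ?_, ?_⟩⟩
  · intro x y hxy
    have h := e.map_rot x.1
    rw [← hxy, hf, hf] at h
    exact congrArg Subtype.val (Sum.inl_injective h)
  · intro x
    have h := e.map_colour x.1
    rw [hf] at h
    exact h
  · intro x y hxy
    have h := e.map_opp x.1
    rw [← hxy, hf, hf] at h
    by_cases hx : P.M.vert (P.M.opp (f x).1) = P.τ
    · exact (Sum.inl_ne_inr (h.trans (glueHalf_stem P Q β (f x) hx))).elim
    · exact congrArg Subtype.val (Sum.inl_injective (h.trans (glueHalf_inner P Q β (f x) hx)))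
  · intro x hx
    have h := e.map_opp x.1
    rw [hg ⟨_, not_not.1 hx⟩, hf] at h
    by_contra hx
    exact Sum.inr_ne_inl (h.trans (glueHalf_inner P Q β (f x) hx))
  · rw [← e.toEquiv.symm_apply_apply r₁, h₁]
    exact hl _
  · have h := hf ⟨r₁, by rw [← e.toEquiv.symm_apply_apply r₁, h₁]; exact hl _⟩
    exact congrArg Subtype.val (Sum.inl_injective (h.symm.trans h₁))
  · intro x y hxy
    have h := e.map_rot x.1
    rw [← hxy, hg, hg] at h
    exact congrArg Subtype.val (Sum.inr_injective h)
  · intro x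
    have h := e.map_colour x.1
    rw [hg] at h
    exact h
  · intro x y hxy
    have h := e.map_opp x.1
    rw [← hxy, hg, hg] at h
    by_cases hx : Q.M.vert (Q.M.opp (g x).1) = Q.τ
    · exact (Sum.inr_ne_inl
        (h.trans (congrArg Sum.swap (glueHalf_stem Q P β.symm (g x) hx)))).elim
    · exact congrArg Subtype.val (Sum.inr_injective
        (h.trans (congrArg Sum.swap (glueHalf_inner Q P β.symm (g x) hx))))
  · intro x hx
    have h := e.map_opp x.1
    rw [hf ⟨_, hx⟩, hg] at h
    by_contra hx
    exact Sum.inl_ne_inr (h.trans (congrArg Sum.swap (glueHalf_inner Q P β.symm (g x) hx)))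
  · rw [← e.toEquiv.symm_apply_apply r₂, h₂]
    exact hr _
  · have h := hg ⟨r₂, by rw [← e.toEquiv.symm_apply_apply r₂, h₂]; exact hr _⟩
    exact congrArg Subtype.val (Sum.inr_injective (h.symm.trans h₂))

/-! ### Uniqueness of pieces -/

section Unique

variable {M : RibbonGraph} {A S : Set M.Vertex} {r : M.Dart} {P P' Q : PointedMap}

theorem IsPiece.of_equivalent (h : IsPiece M A r P) (hP : P.Equivalent P') :
    IsPiece M A r P' := by
  obtain ⟨f, hrot, hcol, hopp, hstem, hr, hroot⟩ := h
  obtain ⟨e, he, heτ⟩ := hP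
  refine ⟨f.trans (e.toEquiv.subtypeEquiv fun d => not_congr (heτ d).symm), fun x y hxy => ?_,
    fun x => ?_, fun x y hxy => ?_, fun x hx => ?_, hr, ?_⟩
  · change e.toEquiv (f y).1 = P'.M.rot (e.toEquiv (f x).1)
    rw [hrot x y hxy, e.map_rot]
  · exact (e.map_colour _).trans (hcol x)
  · change e.toEquiv (f y).1 = P'.M.opp (e.toEquiv (f x).1)
    rw [hopp x y hxy, e.map_opp]
  · change P'.M.vert (P'.M.opp (e.toEquiv (f x).1)) = P'.τ
    rw [← e.map_opp, heτ]
    exact hstem x hx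
  · change e.toEquiv (f ⟨r, hr⟩).1 = P'.corner
    rw [hroot, he]

open Classical in
/-- Two pieces of a map are equivalent as soon as the cyclic orders around their marked vertices
agree. -/
theorem PieceEquiv.equivalent_of_tauRot (f : PieceEquiv M A P) (f' : PieceEquiv M A P')
    (hr : M.vert r ∈ A) (hf : (f.toEquiv ⟨r, hr⟩).1 = P.corner)
    (hf' : (f'.toEquiv ⟨r, hr⟩).1 = P'.corner)
    (hτ : ∀ d, f.tauEquiv.trans f'.tauEquiv.symm (P.tauRot d) =
      P'.tauRot (f.tauEquiv.trans f'.tauEquiv.symm d)) : P.Equivalent P' := by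
  -- Half-edges at the two marked vertices are identified through the cut edges that they replace.
  set k := f.tauEquiv.trans f'.tauEquiv.symm with hk
  let e : P.M.Dart ≃ P'.M.Dart := (Equiv.sumCompl fun d => P.M.vert d = P.τ).symm.trans
    ((Equiv.sumCongr k (f.toEquiv.symm.trans f'.toEquiv)).trans
      (Equiv.sumCompl fun d => P'.M.vert d = P'.τ))
  have hk' : ∀ y, k (f.tauEquiv.symm y) = f'.tauEquiv.symm y := fun y => by simp [hk]
  have e_tau : ∀ d : P.TauDart, e d.1 = (k d).1 := fun d => by
    simp [e, Equiv.sumCompl_symm_apply_of_pos, d.2]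
  have e_rest : ∀ x, e (f.toEquiv x).1 = (f'.toEquiv x).1 := fun x => by
    simp [e, Equiv.sumCompl_symm_apply_of_neg, (f.toEquiv x).2]
  have cases : ∀ d, (∃ y, d = (f.tauEquiv.symm y).1) ∨ ∃ x, d = (f.toEquiv x).1 := by
    intro d
    by_cases hd : P.M.vert d = P.τ
    · obtain ⟨y, hy⟩ := f.tauEquiv.symm.surjective ⟨d, hd⟩
      exact Or.inl ⟨y, by rw [hy]⟩
    · obtain ⟨x, hx⟩ := f.toEquiv.surjective ⟨d, hd⟩
      exact Or.inr ⟨x, by rw [hx]⟩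
  have e_opp : ∀ d, e (P.M.opp d) = P'.M.opp (e d) := by
    intro d
    rcases cases d with ⟨y, rfl⟩ | ⟨x, rfl⟩
    · rw [f.opp_tauEquiv_symm, e_rest, e_tau, hk', f'.opp_tauEquiv_symm]
    · by_cases hx : M.vert (M.opp x.1) ∈ A
      · rw [← f.map_opp x ⟨_, hx⟩ rfl, e_rest, e_rest, f'.map_opp x ⟨_, hx⟩ rfl]
      · rw [f.opp_toEquiv x hx, e_tau, hk', e_rest, f'.opp_toEquiv x hx]
  refine ⟨⟨e, fun d => ?_, e_opp, fun d => ?_⟩, ?_, fun d => ?_⟩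
  · rcases cases d with ⟨y, rfl⟩ | ⟨x, rfl⟩
    · rw [e_tau]
      exact (e_tau (P.tauRot (f.tauEquiv.symm y))).trans (congrArg Subtype.val (hτ _))
    · have hx : M.vert (M.rot x.1) ∈ A := by rw [M.vert_rot]; exact x.2
      rw [← f.map_rot x ⟨_, hx⟩ rfl, e_rest, e_rest, f'.map_rot x ⟨_, hx⟩ rfl]
  · rcases cases d with ⟨y, rfl⟩ | ⟨x, rfl⟩
    -- Pieces do not prescribe colours at `τ`; with two colours available, the opposite half-edge
    -- determines them.
    · have h1 := P.M.colour_opp (f.tauEquiv.symm y).1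
      have h2 := P'.M.colour_opp (e (f.tauEquiv.symm y).1)
      rw [← e_opp, f.opp_tauEquiv_symm, e_rest, f'.map_colour] at h2
      rw [f.opp_tauEquiv_symm, f.map_colour] at h1
      exact colour_eq_of_ne h2.symm h1
    · rw [e_rest, f.map_colour, f'.map_colour]
  · change e P.corner = P'.corner
    rw [← hf, e_rest, hf']
  · rcases cases d with ⟨y, rfl⟩ | ⟨x, rfl⟩
    · change P'.M.vert (e _) = _ ↔ _
      rw [e_tau]
      exact iff_of_true (k _).2 (f.tauEquiv.symm y).2
    · change P'.M.vert (e _) = _ ↔ _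
      rw [e_rest]
      exact iff_of_false (f'.toEquiv x).2 (f.toEquiv x).2

/-- A piece is determined by the map, since it is planar. -/
theorem IsPiece.equivalent {r' : M.Dart} (hM : M.IsPlanarMap) (hP : IsPiece M Sᶜ r P)
    (hP' : IsPiece M Sᶜ r P') (hQ : IsPiece M S r' Q) (cP : P.rest.Connected)
    (cP' : P'.rest.Connected) (cQ : Q.rest.Connected)
    (hc : P.M.vertColour P.τ ≠ Q.M.vertColour Q.τ)
    (hc' : P'.M.vertColour P'.τ ≠ Q.M.vertColour Q.τ) : P.Equivalent P' := by
  obtain ⟨f, hr, hf⟩ := isPiece_iff.1 hP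
  obtain ⟨f', _, hf'⟩ := isPiece_iff.1 hP'
  obtain ⟨g, _, -⟩ := isPiece_iff.1 hQ
  have hβ := (glue_isPlanarMap_iff P Q hc cP cQ _).1 ((glueIso f g hc).symm.isPlanarMap hM)
  have hβ' := (glue_isPlanarMap_iff P' Q hc' cP' cQ _).1 ((glueIso f' g hc').symm.isPlanarMap hM)
  refine f.equivalent_of_tauRot f' hr hf hf' fun d => ?_
  set k := f.tauEquiv.trans f'.tauEquiv.symm with hk
  -- Both matchings with `Q` are planar, hence carry the inverse rotation at `τ` to `Q.tauRot`.
  -- Since `k` carries one matching to the other, it intertwines the rotations.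
  have hkβ : ∀ d, pieceMatching f' g (k d) = pieceMatching f g d := fun d => by
    simp [pieceMatching, hk]
  obtain ⟨d, rfl⟩ := P.tauRot.symm.surjective d
  rw [Equiv.apply_symm_apply, ← Equiv.symm_apply_eq]
  apply (pieceMatching f' g).injective
  rw [hβ', hkβ, hkβ, hβ]

end Unique

/-! ### The bijection -/

theorem Trumpet.rest_connected {k : ℕ} (t : Trumpet k) : t.1.rest.Connected :=
  t.2.1.1.rest_connected

theorem Cornet.rest_connected {k : ℕ} (c : Cornet k) : c.1.rest.Connected :=
  c.2.1.1.1.rest_connected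

theorem CutsInto.unique {k : ℕ} {m : DoublyRootedMap} {t t' : Trumpet k} {c c' : Cornet k}
    (h : CutsInto m t.1 c.1) (h' : CutsInto m t'.1 c'.1) :
    t.1.Equivalent t'.1 ∧ c.1.Equivalent c'.1 := by
  refine ⟨h.1.equivalent m.planar h'.1 h.2 t.rest_connected t'.rest_connected c.rest_connected
    (trumpet_cornet_colour t c) (trumpet_cornet_colour t' c), ?_⟩
  have hS : m.Smin = m.Rminᶜ := (compl_compl _).symm
  have h2 := h.2
  have h2' := h'.2
  rw [hS] at h2 h2'
  exact h2.equivalent m.planar h2' h.1 c.rest_connected c'.rest_connected t.rest_connected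
    (trumpet_cornet_colour t c).symm (trumpet_cornet_colour t c').symm

/-- The cut edges supply the matching in one direction. In the other, a regluing visibly has `t` and
`c` as pieces, and `Smin_eq_of_isPiece` shows that the set separating them is `Smin`. -/
theorem cutsInto_iff {k : ℕ} (t : Trumpet k) (c : Cornet k) (m : DoublyRootedMap) :
    (m.HasMinBlackCutWeight k ∧ CutsInto m t.1 c.1) ↔
      ∃ β : PlanarMatching t c, m.Equivalent (reglue t c β) := by
  constructor
  · rintro ⟨-, hP, hQ⟩
    obtain ⟨f, hr, hf⟩ := isPiece_iff.1 hP
    obtain ⟨g, hr', hg⟩ := isPiece_iff.1 hQ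
    let e := glueIso (S := m.Smin) f g (trumpet_cornet_colour t c)
    refine ⟨⟨_, e.symm.isPlanarMap m.planar⟩, e.symm, (Equiv.symm_apply_eq _).2 ?_,
      (Equiv.symm_apply_eq _).2 ?_⟩
    · have h1 : f.toEquiv ⟨m.corner₁, hr⟩ = ⟨t.1.corner, t.1.root_ne⟩ := Subtype.ext hf
      have h2 := glueDartEquiv_inl (S := m.Smin) f g (trumpet_cornet_colour t c)
        ⟨m.corner₁, hr⟩
      exact h2.symm.trans (congrArg (fun z => e.toEquiv (Sum.inl z)) h1)
    · have h1 : g.toEquiv ⟨m.corner₂, hr'⟩ = ⟨c.1.corner, c.1.root_ne⟩ := Subtype.ext hg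
      have h2 := glueDartEquiv_inr (S := m.Smin) f g (trumpet_cornet_colour t c)
        ⟨m.corner₂, hr'⟩
      exact h2.symm.trans (congrArg (fun z => e.toEquiv (Sum.inr z)) h1)
  · rintro ⟨β, e, h₁, h₂⟩
    obtain ⟨S, hP, hQ⟩ := exists_isPiece_of_iso (hc := trumpet_cornet_colour t c) e h₁ h₂
    obtain ⟨rfl, hk⟩ := Smin_eq_of_isPiece t c hP hQ
    exact ⟨hk, hP, hQ⟩

/-- A gluing of connected maps with marked corners determines the matching. -/
theorem matching_eq_of_iso {P Q : PointedMap} {hc : P.M.vertColour P.τ ≠ Q.M.vertColour Q.τ}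
    (hP : P.rest.Connected) (hQ : Q.rest.Connected) {β β' : Matching P Q}
    (e : RibbonGraph.Iso (glue P Q hc β) (glue P Q hc β'))
    (h₁ : e.toEquiv (Sum.inl ⟨P.corner, P.root_ne⟩) = Sum.inl ⟨P.corner, P.root_ne⟩)
    (h₂ : e.toEquiv (Sum.inr ⟨Q.corner, Q.root_ne⟩) = Sum.inr ⟨Q.corner, Q.root_ne⟩) :
    β = β' := by
  let g := glueGluing P Q hc β
  let g' := glueGluing P Q hc β'
  have hl : ∀ x, e.toEquiv (g.e (Sum.inl x)) = g'.e (Sum.inl x) := by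
    -- The half-edges fixed by `e` include the root and are closed under rotation and inner edges;
    -- connectedness makes them the whole side.
    refine hP.2 {x | e.toEquiv (g.e (Sum.inl x)) = g'.e (Sum.inl x)} (fun x hx => ?_)
      (fun x hx => ?_) _ h₁
    · change e.toEquiv (g.e (Sum.inl x)) = g'.e (Sum.inl x) at hx
      change e.toEquiv (g.e _) = g'.e _
      rw [← g.rot_inl, ← g'.rot_inl, e.map_rot, hx]
    · change e.toEquiv (g.e (Sum.inl x)) = g'.e (Sum.inl x) at hx
      change e.toEquiv (g.e _) = g'.e _
      by_cases h : P.rest.inv x = x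
      · rw [h, hx]
      · rw [← g.opp_inl x h, ← g'.opp_inl x h, e.map_opp, hx]
  have hr : ∀ x, e.toEquiv (g.e (Sum.inr x)) = g'.e (Sum.inr x) := by
    refine hQ.2 {x | e.toEquiv (g.e (Sum.inr x)) = g'.e (Sum.inr x)} (fun x hx => ?_)
      (fun x hx => ?_) _ h₂
    · change e.toEquiv (g.e (Sum.inr x)) = g'.e (Sum.inr x) at hx
      change e.toEquiv (g.e _) = g'.e _
      rw [← g.rot_inr, ← g'.rot_inr, e.map_rot, hx]
    · change e.toEquiv (g.e (Sum.inr x)) = g'.e (Sum.inr x) at hx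
      change e.toEquiv (g.e _) = g'.e _
      by_cases h : Q.rest.inv x = x
      · rw [h, hx]
      · rw [← g.opp_inr x h, ← g'.opp_inr x h, e.map_opp, hx]
  have hγ : ∀ s, g.γ s = g'.γ s := fun s => by
    have h := e.map_opp (g.e (Sum.inl s.1))
    rw [g.opp_stem, hr, hl, g'.opp_stem] at h
    exact Subtype.ext (Sum.inr_injective (g'.e.injective h))
  refine Equiv.ext fun d => ?_
  obtain ⟨s, rfl⟩ := P.stemEquiv.surjective d
  exact Q.stemEquiv.symm.injective (hγ s)

theorem card_planarMatching {k : ℕ} (t : Trumpet k) (c : Cornet k) :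
    Nat.card (PlanarMatching t c) = k :=
  (card_planar_matching t.1 c.1 (trumpet_cornet_colour t c) t.rest_connected c.rest_connected
    (t.2.2.trans c.2.2.symm)).trans t.2.2

theorem mainTheorem4 (k : ℕ) (hk : 1 ≤ k) :
    (∀ m : DoublyRooted k, m.1.Smin ∈ m.1.minimalBlackCuts ∧ m.1.M.cutWeight m.1.Smin = k) ∧
    ∃ Φ : DoublyRootedMaps k → Trumpets k × Cornets k,
      (∀ (m : DoublyRooted k) (t : Trumpet k) (c : Cornet k),
        Φ m.cls = (t.cls, c.cls) ↔ CutsInto m.1 t.1 c.1) ∧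
      (∀ p : Trumpets k × Cornets k, Nat.card {x : DoublyRootedMaps k // Φ x = p} = k) ∧
      (∀ (t : Trumpet k) (c : Cornet k),
        Nat.card (PlanarMatching t c) = k ∧
        ∀ m : DoublyRootedMap,
          (m.HasMinBlackCutWeight k ∧ CutsInto m t.1 c.1) ↔
            ∃ β : PlanarMatching t c, m.Equivalent (reglue t c β)) := by
  refine ⟨fun m => m.2.Smin_mem, ?_⟩
  have hΦ : ∀ x : DoublyRootedMaps k, ∃ p : Trumpets k × Cornets k,
      ∀ (m : DoublyRooted k), x = m.cls → ∀ (t : Trumpet k) (c : Cornet k),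
        p = (t.cls, c.cls) ↔ CutsInto m.1 t.1 c.1 := by
    rintro ⟨m₀⟩
    obtain ⟨t₀, c₀, h₀⟩ := exists_cutsInto m₀
    refine ⟨(t₀.cls, c₀.cls), fun m hm t c => ?_⟩
    have hm : m₀.1.Equivalent m.1 := Quotient.exact (s := DoublyRooted.isoSetoid k) hm
    -- Independence of the representative: being isomorphic to a given regluing is invariant under
    -- isomorphism, so `cutsInto_iff` transports the cutting from `m₀` to `m`.
    obtain ⟨β, hβ⟩ := (cutsInto_iff t₀ c₀ m₀.1).1 ⟨m₀.2, h₀⟩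
    have h₁ : CutsInto m.1 t₀.1 c₀.1 := ((cutsInto_iff t₀ c₀ m.1).2
      ⟨β, DoublyRootedMap.isoSetoid.trans (DoublyRootedMap.isoSetoid.symm hm) hβ⟩).2
    rw [Prod.mk.injEq]
    constructor
    · rintro ⟨ht, hc⟩
      exact ⟨h₁.1.of_equivalent (Quotient.exact (s := Trumpet.isoSetoid k) ht),
        h₁.2.of_equivalent (Quotient.exact (s := Cornet.isoSetoid k) hc)⟩
    · intro h
      obtain ⟨ht, hc⟩ := h₁.unique h
      exact ⟨Quotient.sound (s := Trumpet.isoSetoid k) ht,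
        Quotient.sound (s := Cornet.isoSetoid k) hc⟩
  choose Φ hΦ using hΦ
  refine ⟨Φ, fun m t c => hΦ _ m rfl t c, ?_,
    fun t c => ⟨card_planarMatching t c, cutsInto_iff t c⟩⟩
  rintro ⟨⟨t⟩, ⟨c⟩⟩
  have hmem : ∀ β : PlanarMatching t c, (reglue t c β).HasMinBlackCutWeight k ∧
      CutsInto (reglue t c β) t.1 c.1 := fun β =>
    (cutsInto_iff t c _).2 ⟨β, DoublyRootedMap.isoSetoid.refl _⟩
  refine Eq.trans (Eq.symm ?_) (card_planarMatching t c)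
  -- Planar matchings biject with the fibre: rigidity at the two root corners gives injectivity and
  -- `cutsInto_iff` gives surjectivity.
  refine Nat.card_congr (Equiv.ofBijective
    (fun β => ⟨DoublyRooted.cls ⟨reglue t c β, (hmem β).1⟩,
      (hΦ _ ⟨reglue t c β, (hmem β).1⟩ rfl t c).2 (hmem β).2⟩) ⟨fun β β' h => ?_, ?_⟩)
  · obtain ⟨e, h₁, h₂⟩ : (reglue t c β).Equivalent (reglue t c β') :=
      Quotient.exact (s := DoublyRooted.isoSetoid k) (congrArg Subtype.val h)
    exact Subtype.ext (matching_eq_of_iso (hc := trumpet_cornet_colour t c) t.rest_connected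
      c.rest_connected e h₁ h₂)
  · rintro ⟨⟨m⟩, hm⟩
    obtain ⟨β, hβ⟩ := (cutsInto_iff t c m.1).1 ⟨m.2, (hΦ _ m rfl t c).1 hm⟩
    refine ⟨β, Subtype.ext (Quotient.sound (s := DoublyRooted.isoSetoid k) ?_)⟩
    exact DoublyRootedMap.isoSetoid.symm hβ
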